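/- Let $\mathbf F$ be an algebraically closed field of characteristic $p>2$. A Lie superalgebra over $\mathbf F$ is a $\mathbb Z/2$-graded vector space $\mathfrak g=\mathfrak g_{\bar 0}\oplus\mathfrak g_{\bar 1}$ with a graded bilinear bracket such that $[a,b]=-(-1)^{\mathrm p(a)\mathrm p(b)}[b,a]$ and $[a,[b,c]]=[[a,b],c]+(-1)^{\mathrm p(a)\mathrm p(b)}[b,[a,c]]$ for homogeneous $a,b$ of parities $\mathrm p(a),\mathrm p(b)$ and all $c$. It is restricted if $\mathfrak g_{\bar 0}$ is a restricted Lie algebra with $p$-mapping $x\mapsto x^{[p]}$ and $\mathfrak g_{\bar 1}$ is a restricted $\mathfrak g_{\bar 0}$-module under the adjoint action, that is, $(\mathrm{ad}\,x)^p=\mathrm{ad}(x^{[p]})$ on $\mathfrak g_{\bar 1}$ for all $x\in\mathfrak g_{\bar 0}$. Let $U(\mathfrak g)$ be the universal enveloping algebra, the quotient of the tensor algebra of $\mathfrak g$ by the relations $ab-(-1)^{\mathrm p(a)\mathrm p(b)}ba=[a,b]$ for homogeneous $a,b\in\mathfrak g$. For $\chi\in\mathfrak g_{\bar 0}^*$ let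 $u(\mathfrak g,\chi)$ be the quotient of $U(\mathfrak g)$ by the two-sided ideal generated by the elements $x^p-x^{[p]}-\chi(x)^p\cdot 1$, $x\in\mathfrak g_{\bar 0}$; it is a superalgebra with the $\mathbb Z/2$-grading in which a product $x_1\cdots x_k$ of homogeneous elements of $\mathfrak g$ has parity $\sum_i\mathrm p(x_i)$. A finite-dimensional associative superalgebra $A$ is called a Frobenius superalgebra if it has a non-degenerate bilinear form $f$ that is invariant, i.e. $f(ab,c)=f(a,bc)$ for all $a,b,c\in A$. It is called supersymmetric if $f$ can be chosen such that, moreover, $f(a,b)=(-1)^{\mathrm p(a)\mathrm p(b)}f(b,a)$ for all homogeneous $a,b\in A$. For an endomorphism $T$ of $\mathfrak g$ with diagonal blocks $\alpha:\mathfrak g_{\bar 0}\to\mathfrak g_{\bar 0}$ and $\delta:\mathfrak g_{\bar 1}\to\mathfrak g_{\bar 1}$ put $\mathrm{str}(T)=\mathrm{tr}(\alpha)-\mathrm{tr}(\delta)$. **Proposition 5.4.** Let $\mathfrak g$ be a finite-dimensional restricted Lie superalgebra over $\mathbf F$ and let $\chi\in\mathfrak g_{\bar 0}^*$. Then $u(\mathfrak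 g,\chi)$ is a Frobenius superalgebra. If moreover $\mathrm{str}(\mathrm{ad}\,x)=0$ for all $x\in\mathfrak g$, then $u(\mathfrak g,\chi)$ is supersymmetric. -/

import Mathlib

noncomputable section

/-- The Koszul sign `(-1)^(i * j)` attached to two parities. -/
def koszulSign (F : Type*) [Field F] (i j : ZMod 2) : F := (-1) ^ (i.val * j.val)

/-- A Lie superalgebra structure on the vector space `V`: a `ℤ/2`-grading together with a graded
bilinear bracket that is super-antisymmetric and satisfies the super Jacobi identity. -/
structure LieSuperalgebra (F V : Type*) [Field F] [AddCommGroup V] [Module F V] where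
  /-- The even part `part 0` and the odd part `part 1`. -/
  part : ZMod 2 → Submodule F V
  isInternal : DirectSum.IsInternal part
  /-- The bracket, `bracket x = ad x`. -/
  bracket : V →ₗ[F] V →ₗ[F] V
  bracket_mem : ∀ {i j : ZMod 2} {x y : V}, x ∈ part i → y ∈ part j → bracket x y ∈ part (i + j)
  skew : ∀ {i j : ZMod 2} {x y : V}, x ∈ part i → y ∈ part j →
    bracket x y = -(koszulSign F i j • bracket y x)
  jacobi : ∀ {i j : ZMod 2} {x y : V}, x ∈ part i → y ∈ part j → ∀ z : V,
    bracket x (bracket y z) =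
      bracket (bracket x y) z + koszulSign F i j • bracket y (bracket x z)

namespace LieSuperalgebra

variable {F V : Type*} [Field F] [AddCommGroup V] [Module F V]

instance instDecomposition (g : LieSuperalgebra F V) : DirectSum.Decomposition g.part :=
  g.isInternal.chooseDecomposition

/-- The projection of `V` onto its component of parity `i`. -/
def proj (g : LieSuperalgebra F V) (i : ZMod 2) : V →ₗ[F] g.part i :=
  DirectSum.component F (ZMod 2) (fun i => g.part i) i ∘ₗ
    (DirectSum.decomposeLinearEquiv g.part).toLinearMap

/-- The supertrace `tr α - tr δ` of an endomorphism with diagonal blocks `α` (even to even) and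
`δ` (odd to odd). -/
def supertrace (g : LieSuperalgebra F V) (A : V →ₗ[F] V) : F :=
  LinearMap.trace F (g.part 0) (g.proj 0 ∘ₗ A ∘ₗ (g.part 0).subtype) -
    LinearMap.trace F (g.part 1) (g.proj 1 ∘ₗ A ∘ₗ (g.part 1).subtype)

/-- `g.adCoeff x y k j` is the coefficient of `t ^ j` in `(ad (t x + y)) ^ k (x)`, where `t` is a
formal variable. -/
def adCoeff (g : LieSuperalgebra F V) (x y : V) : ℕ → ℕ → V
  | 0, 0 => x
  | 0, _ + 1 => 0
  | k + 1, 0 => g.bracket y (g.adCoeff x y k 0)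
  | k + 1, j + 1 => g.bracket x (g.adCoeff x y k j) + g.bracket y (g.adCoeff x y k (j + 1))

/-- Jacobson's polynomials `s_i(x, y)`, `1 ≤ i ≤ p - 1`, determined by
`(ad (t x + y)) ^ (p - 1) (x) = ∑ i s_i(x, y) t ^ (i - 1)`. -/
def jacobsonS (g : LieSuperalgebra F V) (p : ℕ) (x y : V) (i : ℕ) : V :=
  (i : F)⁻¹ • g.adCoeff x y (p - 1) (i - 1)

/-- The relations `x y = (-1)^(p(x) p(y)) y x + [x, y]` of the universal enveloping algebra. -/
inductive EnvelopingRel (g : LieSuperalgebra F V) : TensorAlgebra F V → TensorAlgebra F V → Prop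
  | comm {i j : ZMod 2} {x y : V} (hx : x ∈ g.part i) (hy : y ∈ g.part j) :
      EnvelopingRel g
        (TensorAlgebra.ι F x * TensorAlgebra.ι F y)
        (koszulSign F i j • (TensorAlgebra.ι F y * TensorAlgebra.ι F x) +
          TensorAlgebra.ι F (g.bracket x y))

/-- The universal enveloping algebra `U(g)`. -/
def Enveloping (g : LieSuperalgebra F V) := RingQuot g.EnvelopingRel

instance instRingEnveloping (g : LieSuperalgebra F V) : Ring g.Enveloping :=
  inferInstanceAs (Ring (RingQuot g.EnvelopingRel))

instance instAlgebraEnveloping (g : LieSuperalgebra F V) : Algebra F g.Enveloping :=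
  inferInstanceAs (Algebra F (RingQuot g.EnvelopingRel))

/-- The quotient map from the tensor algebra to `U(g)`. -/
def envMk (g : LieSuperalgebra F V) : TensorAlgebra F V →ₐ[F] g.Enveloping :=
  RingQuot.mkAlgHom F g.EnvelopingRel

/-- The canonical map `g → U(g)`. -/
def envι (g : LieSuperalgebra F V) : V →ₗ[F] g.Enveloping :=
  g.envMk.toLinearMap ∘ₗ TensorAlgebra.ι F

end LieSuperalgebra

/-- A restricted Lie superalgebra: a Lie superalgebra with a `p`-mapping on its even part which
makes the even part a restricted Lie algebra and the odd part a restricted module over it; the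
field `bracket_pmap` contains both the condition `ad (x^[p]) = (ad x)^p` on the even part and the
restrictedness of the odd part. -/
structure RestrictedLieSuperalgebra (F V : Type*) [Field F] [AddCommGroup V] [Module F V] (p : ℕ)
    extends LieSuperalgebra F V where
  /-- The `p`-mapping `x ↦ x^[p]`. -/
  pmap : part 0 → part 0
  bracket_pmap : ∀ (x : part 0) (z : V), bracket (pmap x) z = ((bracket (x : V)) ^ p) z
  pmap_smul : ∀ (a : F) (x : part 0), pmap (a • x) = a ^ p • pmap x
  pmap_add : ∀ x y : part 0, (pmap (x + y) : V) = pmap x + pmap y +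
    ∑ i ∈ Finset.Icc 1 (p - 1), toLieSuperalgebra.jacobsonS p x y i

namespace RestrictedLieSuperalgebra

variable {F V : Type*} [Field F] [AddCommGroup V] [Module F V] {p : ℕ}

/-- The relations `x^p = x^[p] + χ(x)^p`, for `x` even, on `U(g)`. -/
inductive ReducedRel (g : RestrictedLieSuperalgebra F V p) (χ : Module.Dual F (g.part 0)) :
    g.Enveloping → g.Enveloping → Prop
  | pow (x : g.part 0) :
      ReducedRel g χ (g.envι (x : V) ^ p)
        (g.envι (g.pmap x : V) + algebraMap F g.Enveloping (χ x ^ p))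

/-- The reduced enveloping algebra `u(g, χ)`: the quotient of `U(g)` by the two-sided ideal
generated by the elements `x^p - x^[p] - χ(x)^p`, `x` even. -/
def ReducedEnveloping (g : RestrictedLieSuperalgebra F V p) (χ : Module.Dual F (g.part 0)) :=
  RingQuot (g.ReducedRel χ)

instance instRingReducedEnveloping (g : RestrictedLieSuperalgebra F V p)
    (χ : Module.Dual F (g.part 0)) : Ring (g.ReducedEnveloping χ) :=
  inferInstanceAs (Ring (RingQuot (g.ReducedRel χ)))

instance instAlgebraReducedEnveloping (g : RestrictedLieSuperalgebra F V p)
    (χ : Module.Dual F (g.part 0)) : Algebra F (g.ReducedEnveloping χ) :=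
  inferInstanceAs (Algebra F (RingQuot (g.ReducedRel χ)))

/-- The quotient map `U(g) → u(g, χ)`. -/
def redMk (g : RestrictedLieSuperalgebra F V p) (χ : Module.Dual F (g.part 0)) :
    g.Enveloping →ₐ[F] g.ReducedEnveloping χ :=
  RingQuot.mkAlgHom F (g.ReducedRel χ)

/-- The canonical map `g → u(g, χ)`. -/
def redι (g : RestrictedLieSuperalgebra F V p) (χ : Module.Dual F (g.part 0)) :
    V →ₗ[F] g.ReducedEnveloping χ :=
  (g.redMk χ).toLinearMap ∘ₗ g.envι

/-- The component of parity `θ` of `u(g, χ)`: the span of the products `x₁ ⋯ x_k` of homogeneous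
elements `x_i` of `g` whose parities add up to `θ`. -/
def redPart (g : RestrictedLieSuperalgebra F V p) (χ : Module.Dual F (g.part 0)) (θ : ZMod 2) :
    Submodule F (g.ReducedEnveloping χ) :=
  Submodule.span F {a | ∃ l : List (ZMod 2 × V), (∀ q ∈ l, q.2 ∈ g.part q.1) ∧
    (l.map Prod.fst).sum = θ ∧ a = (l.map fun q => g.redι χ q.2).prod}

section Grading

variable (g : RestrictedLieSuperalgebra F V p) (χ : Module.Dual F (g.part 0))

instance instGradedMonoid : SetLike.GradedMonoid (g.redPart χ) where
  one_mem := Submodule.subset_span ⟨[], by simp, by simp, by simp⟩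
  mul_mem := by
    intro i j a b ha hb
    have h := Submodule.mul_mem_mul ha hb
    unfold redPart at h
    rw [Submodule.span_mul_span] at h
    refine Submodule.span_mono ?_ h
    rintro _ ⟨_, ⟨l, hl, hs, rfl⟩, _, ⟨l', hl', hs', rfl⟩, rfl⟩
    refine ⟨l ++ l', ?_, by simp [hs, hs'], by simp⟩
    intro q hq
    rcases List.mem_append.1 hq with h | h
    · exact hl q h
    · exact hl' q h

theorem redι_mem {i : ZMod 2} {x : V} (hx : x ∈ g.part i) : g.redι χ x ∈ g.redPart χ i :=
  Submodule.subset_span ⟨[(i, x)], by simpa using hx, by simp, by simp⟩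

/-- The map `g_i → u(g, χ)_i`. -/
def redιPart (i : ZMod 2) : g.part i →ₗ[F] g.redPart χ i :=
  ((g.redι χ) ∘ₗ (g.part i).subtype).codRestrict _ fun x => g.redι_mem χ x.2

/-- The map from `g` to the direct sum of the two components of `u(g, χ)`. -/
def gradedι : V →ₗ[F] DirectSum (ZMod 2) fun i => g.redPart χ i :=
  DirectSum.toModule F (ZMod 2) _
      (fun i => DirectSum.lof F (ZMod 2) (fun i => g.redPart χ i) i ∘ₗ g.redιPart χ i) ∘ₗ
    (DirectSum.decomposeLinearEquiv g.part).toLinearMap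

theorem gradedι_of_mem {i : ZMod 2} {x : V} (hx : x ∈ g.part i) :
    g.gradedι χ x =
      DirectSum.of (fun i => g.redPart χ i) i ⟨g.redι χ x, g.redι_mem χ hx⟩ := by
  simp only [gradedι, LinearMap.comp_apply, LinearEquiv.coe_coe,
    DirectSum.decomposeLinearEquiv_apply]
  rw [DirectSum.decompose_of_mem _ hx, ← DirectSum.lof_eq_of F, DirectSum.toModule_lof]
  rfl

theorem of_congr {i j : ZMod 2} (h : i = j) {a : g.redPart χ i} {b : g.redPart χ j}
    (hab : (a : g.ReducedEnveloping χ) = b) :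
    DirectSum.of (fun i => g.redPart χ i) i a = DirectSum.of (fun i => g.redPart χ i) j b := by
  subst h
  rw [Subtype.ext hab]

theorem redι_comm {i j : ZMod 2} {x y : V} (hx : x ∈ g.part i) (hy : y ∈ g.part j) :
    g.redι χ x * g.redι χ y =
      koszulSign F i j • (g.redι χ y * g.redι χ x) + g.redι χ (g.bracket x y) := by
  have h : g.envMk _ = g.envMk _ := RingQuot.mkAlgHom_rel F
    (LieSuperalgebra.EnvelopingRel.comm (g := g.toLieSuperalgebra) hx hy)
  have h2 := congrArg (g.redMk χ) h
  simp only [map_mul, map_add, map_smul] at h2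
  exact h2

theorem redι_pow (x : g.part 0) :
    g.redι χ (x : V) ^ p =
      g.redι χ (g.pmap x : V) + algebraMap F (g.ReducedEnveloping χ) (χ x ^ p) := by
  have h : g.redMk χ _ = g.redMk χ _ :=
    RingQuot.mkAlgHom_rel F (ReducedRel.pow (g := g) (χ := χ) x)
  rw [map_pow, map_add, AlgHom.commutes] at h
  exact h

/-- The algebra homomorphism from `U(g)` to the direct sum of the components of `u(g, χ)`. -/
def gradedEnvHom : g.Enveloping →ₐ[F] DirectSum (ZMod 2) fun i => g.redPart χ i :=
  RingQuot.liftAlgHom F ⟨TensorAlgebra.lift F (g.gradedι χ), by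
    rintro _ _ ⟨hx, hy⟩
    rename_i i j x y
    simp only [map_add, map_mul, map_smul, TensorAlgebra.lift_ι_apply]
    rw [g.gradedι_of_mem χ hx, g.gradedι_of_mem χ hy,
      g.gradedι_of_mem χ (g.bracket_mem hx hy), DirectSum.of_mul_of, DirectSum.of_mul_of,
      g.of_congr χ (add_comm j i) (b := ⟨g.redι χ y * g.redι χ x, by
        rw [add_comm]; exact SetLike.mul_mem_graded (g.redι_mem χ hy) (g.redι_mem χ hx)⟩) rfl]
    simp only [← DirectSum.lof_eq_of F]
    rw [← map_smul, ← map_add]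
    congr 1
    exact Subtype.ext (g.redι_comm χ hx hy)⟩

theorem gradedEnvHom_envι (x : V) : g.gradedEnvHom χ (g.envι x) = g.gradedι χ x := by
  have h : g.gradedEnvHom χ (g.envMk (TensorAlgebra.ι F x)) =
      TensorAlgebra.lift F (g.gradedι χ) (TensorAlgebra.ι F x) :=
    RingQuot.liftAlgHom_mkAlgHom_apply F _ _ _
  rwa [TensorAlgebra.lift_ι_apply] at h

/-- The algebra homomorphism from `u(g, χ)` to the direct sum of its components. -/
def gradedHom : g.ReducedEnveloping χ →ₐ[F] DirectSum (ZMod 2) fun i => g.redPart χ i :=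
  RingQuot.liftAlgHom F ⟨g.gradedEnvHom χ, by
    rintro _ _ ⟨x⟩
    rw [map_add, map_pow, AlgHom.commutes, gradedEnvHom_envι, gradedEnvHom_envι]
    rw [g.gradedι_of_mem χ x.2, g.gradedι_of_mem χ (g.pmap x).2, DirectSum.ofPow,
      DirectSum.algebraMap_apply,
      g.of_congr χ (smul_zero p) (b := ⟨g.redι χ x ^ p, by
        simpa using SetLike.pow_mem_graded p (g.redι_mem χ x.2)⟩) rfl,
      ← map_add]
    congr 1
    exact Subtype.ext (g.redι_pow χ x)⟩

theorem gradedHom_redι (x : V) : g.gradedHom χ (g.redι χ x) = g.gradedι χ x := by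
  have h : g.gradedHom χ (g.redMk χ (g.envι x)) = g.gradedEnvHom χ (g.envι x) :=
    RingQuot.liftAlgHom_mkAlgHom_apply F _ _ _
  rwa [gradedEnvHom_envι] at h

theorem coe_gradedι (x : V) :
    DirectSum.coeAlgHom (g.redPart χ) (g.gradedι χ x) = g.redι χ x := by
  induction x using DirectSum.Decomposition.inductionOn g.part with
  | zero => simp
  | homogeneous x => rw [g.gradedι_of_mem χ x.2, DirectSum.coeAlgHom_of]
  | add x y hx hy => rw [map_add, map_add, map_add, hx, hy]

/-- `u(g, χ)` is an associative superalgebra. -/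
instance instGradedAlgebra : GradedAlgebra (g.redPart χ) :=
  GradedAlgebra.ofAlgHom (g.redPart χ) (g.gradedHom χ)
    (by
      apply RingQuot.ringQuot_ext'
      apply RingQuot.ringQuot_ext'
      apply TensorAlgebra.hom_ext
      ext x
      have h := g.coe_gradedι χ x
      rw [← gradedHom_redι] at h
      exact h)
    (by
      rintro i ⟨a, ha⟩
      change g.gradedHom χ a = _
      induction ha using Submodule.span_induction with
      | mem a ha =>
        obtain ⟨l, hl, rfl, rfl⟩ := ha
        induction l with
        | nil =>
          simp only [List.map_nil, List.prod_nil, map_one]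
          rfl
        | cons q l ih =>
          have hq := hl q (by simp)
          have hl' : ∀ r ∈ l, r.2 ∈ g.part r.1 := fun r hr => hl r (by simp [hr])
          simp only [List.map_cons, List.prod_cons, map_mul]
          rw [ih hl', gradedHom_redι, g.gradedι_of_mem χ hq, DirectSum.of_mul_of]
          exact g.of_congr χ (by simp) rfl
      | zero => rw [map_zero]; exact (map_zero _).symm
      | add a b ha hb iha ihb => rw [map_add, iha, ihb, ← map_add]; rfl
      | smul c a ha iha =>
        rw [map_smul, iha, ← DirectSum.lof_eq_of F, ← map_smul]; rfl)

end Grading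

end RestrictedLieSuperalgebra

section Frobenius

variable {F A : Type*} [Field F] [Ring A] [Algebra F A]

/-- A bilinear form on an algebra is invariant if `f (a b, c) = f (a, b c)`. -/
def IsInvariantForm (f : LinearMap.BilinForm F A) : Prop :=
  ∀ a b c : A, f (a * b) c = f a (b * c)

/-- A bilinear form on a superspace is supersymmetric if `f (a, b) = (-1)^(p(a) p(b)) f (b, a)` for
homogeneous `a`, `b`. -/
def IsSupersymmetricForm (𝒜 : ZMod 2 → Submodule F A) (f : LinearMap.BilinForm F A) : Prop :=
  ∀ (i j : ZMod 2) (a b : A), a ∈ 𝒜 i → b ∈ 𝒜 j → f a b = koszulSign F i j * f b a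

/-- A Frobenius superalgebra: a finite-dimensional associative superalgebra with a non-degenerate
invariant bilinear form. -/
def IsFrobeniusSuperalgebra (𝒜 : ZMod 2 → Submodule F A) [GradedAlgebra 𝒜] : Prop :=
  FiniteDimensional F A ∧ ∃ f : LinearMap.BilinForm F A, f.Nondegenerate ∧ IsInvariantForm f

/-- A Frobenius superalgebra is supersymmetric if its form can be chosen supersymmetric. -/
def IsSupersymmetricSuperalgebra (𝒜 : ZMod 2 → Submodule F A) [GradedAlgebra 𝒜] : Prop :=
  FiniteDimensional F A ∧ ∃ f : LinearMap.BilinForm F A,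
    f.Nondegenerate ∧ IsInvariantForm f ∧ IsSupersymmetricForm 𝒜 f

end Frobenius

end

/-! ### Rewriting of words in a free algebra -/

/-! By a PBW theorem, `u(g, χ)` has a basis of ordered monomials in a homogeneous basis of `g`, with
exponents below `p` on even vectors and, outside characteristic three, below two on odd ones. Let
`L` be the coefficient of the highest monomial and put `f (a, b) = L (a b)`; invariance is
associativity. Up to shorter words, letters commute up to sign and full powers vanish. Hence, on
words no longer than the highest monomial, `L` is nonzero exactly on the permutations of that
monomial (`map_ne_zero_of_perm`, `map_eq_zero_of_not_perm`). Pairing a longest monomial of `a` with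
its complement then gives nondegeneracy (`exists_pairing_ne_zero`).

For supersymmetry it is enough to compare `L (x b)` with `L (b x)` for `x` in `g` and `b` an ordered
monomial (`supersymmetric_of_redι`). If `b` is not the highest monomial, moving `x` across it only
creates words too short for `L`. If `b` is the highest one and `x` is odd, both values vanish by
parity. If `x` is even, the commutator of `x` with `b` has top coefficient the sum of the diagonal
entries of `ad x` weighted by the exponents of `b`. Since `p - 1 = -1` in the field, this is `-str
(ad x)` (`map_commutator`, `sum_height_sub_one_smul`).

The PBW theorem comes from the diamond lemma (`exists_functional_of_irreducible`), in a form that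
directly produces functionals on the free algebra over a basis of `g`. The rules sort letters and
reduce powers. Their ambiguities are resolved by the Jacobi identity, by `ad (x^[p]) = (ad x)^p`,
and by its odd analogue for `x ^ 2 = [x, x] / 2`. Jacobson's formula extends the `p`-th power
relation from basis vectors to the whole even part, so the rules generate all relations of `u(g,
χ)`.

In characteristic three the axioms do not force `[x, [x, x]] = 0` for odd `x`. These cubes are
central in `g` and vanish in `U(g)`. The basis is therefore chosen to contain a basis of their span,
whose vectors get height one, that is, are rewritten to zero; being central, they do not contribute
to the supertrace of `ad x`. -/

namespace FreeAlgebra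

section Word

variable {F ι : Type*} [Field F]

/-- The monomial of the free algebra attached to a word. -/
noncomputable def word (F : Type*) {ι : Type*} [Field F] (l : List ι) : FreeAlgebra F ι :=
  (l.map (FreeAlgebra.ι F)).prod

@[simp]
theorem word_nil : word F ([] : List ι) = 1 := rfl

theorem word_singleton (i : ι) : word F [i] = FreeAlgebra.ι F i := by simp [word]

theorem word_cons (i : ι) (l : List ι) : word F (i :: l) = word F [i] * word F l := by
  simp [word]

theorem word_append (l m : List ι) : word F (l ++ m) = word F l * word F m := by
  simp [word]

theorem word_replicate (n : ℕ) (i : ι) : word F (List.replicate n i) = word F [i] ^ n := by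
  simp [word]

theorem basisFreeMonoid_eq_word (l : List ι) :
    FreeAlgebra.basisFreeMonoid F ι (FreeMonoid.ofList l) = word F l := by
  change FreeAlgebra.equivMonoidAlgebraFreeMonoid.symm
    (MonoidAlgebra.of F (FreeMonoid ι) (FreeMonoid.ofList l)) = _
  change MonoidAlgebra.lift F (FreeAlgebra F ι) (FreeMonoid ι)
    (FreeMonoid.lift (FreeAlgebra.ι F)) _ = _
  rw [MonoidAlgebra.lift_of, FreeMonoid.lift_apply]
  rfl

theorem exists_functional_word (g : List ι → F) :
    ∃ f : FreeAlgebra F ι →ₗ[F] F, ∀ l, f (word F l) = g l :=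
  ⟨(FreeAlgebra.basisFreeMonoid F ι).constr F fun m => g m.toList, fun l => by
    rw [← basisFreeMonoid_eq_word, Module.Basis.constr_basis]; rfl⟩

theorem span_range_word : Submodule.span F (Set.range (word F (ι := ι))) = ⊤ := by
  rw [← (FreeAlgebra.basisFreeMonoid F ι).span_eq]
  congr 1
  ext x
  exact ⟨fun ⟨l, hl⟩ => ⟨FreeMonoid.ofList l, by rw [basisFreeMonoid_eq_word, hl]⟩,
    fun ⟨m, hm⟩ => ⟨m.toList, by rw [← hm, ← basisFreeMonoid_eq_word]; rfl⟩⟩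

end Word

/-! ### The degree-lexicographic order on words -/

section Order

variable {ι : Type*} [LinearOrder ι]

/-- The degree-lexicographic order on words. -/
abbrev WordLT (u w : List ι) : Prop := List.Shortlex (· < ·) u w

/-- Equal lengths are essential: a proper prefix precedes its extensions, and appending `t` to both
can reverse this. -/
theorem lex_append_right {u v : List ι} (h : List.Lex (· < ·) u v) (hl : u.length = v.length)
    (t : List ι) : List.Lex (· < ·) (u ++ t) (v ++ t) := by
  induction h with
  | nil => simp at hl
  | cons h ih => exact List.Lex.cons (ih (by simpa using hl))
  | rel h => exact List.Lex.rel h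

/-- This compatibility with concatenation on both sides lets a rule that decreases its left-hand
side decrease every word containing it. -/
theorem WordLT.context {u v : List ι} (h : WordLT u v) (A B : List ι) :
    WordLT (A ++ u ++ B) (A ++ v ++ B) := by
  rw [List.append_assoc, List.append_assoc]
  refine List.Shortlex.append_left ?_ A
  rcases List.shortlex_def.1 h with h | ⟨h, hl⟩
  · exact List.Shortlex.of_length_lt (by simpa using h)
  · exact List.Shortlex.of_lex (by simp [h]) (lex_append_right hl h B)

theorem wordLT_of_lt {i j : ι} (h : i < j) {u v : List ι} (hl : u.length = v.length)
    (A : List ι) : WordLT (A ++ i :: u) (A ++ j :: v) :=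
  List.Shortlex.append_left (List.Shortlex.of_lex (by simp [hl]) (List.Lex.rel h)) A

end Order

/-! ### Rewriting rules and the diamond lemma -/

section Rewriting

variable {F ι : Type*} [Field F]

/-- The span of the differences `A (r - t) B`, for the rewriting rules `r → t` and the words
`A r B` in the set `S`. -/
def relSpan (Rule : List ι → FreeAlgebra F ι → Prop) (S : Set (List ι)) :
    Submodule F (FreeAlgebra F ι) :=
  Submodule.span F {x | ∃ A r t B, Rule r t ∧ A ++ r ++ B ∈ S ∧
    x = word F A * (word F r - t) * word F B}

/-- A word is irreducible if no rule applies to it. -/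
def IrredWord (Rule : List ι → FreeAlgebra F ι → Prop) (w : List ι) : Prop :=
  ∀ A r t B, Rule r t → w ≠ A ++ r ++ B

variable {Rule : List ι → FreeAlgebra F ι → Prop}

theorem relSpan_mono {S S' : Set (List ι)} (h : S ⊆ S') : relSpan Rule S ≤ relSpan Rule S' :=
  Submodule.span_mono fun _ ⟨A, r, t, B, hr, hS, hx⟩ => ⟨A, r, t, B, hr, h hS, hx⟩

theorem mem_relSpan {S : Set (List ι)} {A r B : List ι} {t : FreeAlgebra F ι} (hr : Rule r t)
    (hS : A ++ r ++ B ∈ S) : word F A * (word F r - t) * word F B ∈ relSpan Rule S :=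
  Submodule.subset_span ⟨A, r, t, B, hr, hS, rfl⟩

theorem word_mul_mem_relSpan {S S' : Set (List ι)} {A B : List ι}
    (h : ∀ u ∈ S, A ++ u ++ B ∈ S') {z : FreeAlgebra F ι} (hz : z ∈ relSpan Rule S) :
    word F A * z * word F B ∈ relSpan Rule S' := by
  induction hz using Submodule.span_induction with
  | mem x hx =>
    obtain ⟨A', r, t, B', hr, hS, rfl⟩ := hx
    have := mem_relSpan (S := S') (A := A ++ A') (B := B' ++ B) hr
      (by simpa [List.append_assoc] using h _ hS)
    simpa [word_append, mul_assoc] using this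
  | zero => simp
  | add x y _ _ hx hy => simpa [mul_add, add_mul] using add_mem hx hy
  | smul c x _ hx => simpa using Submodule.smul_mem _ c hx

/-- The submodule `T` is left arbitrary so that the kernel of a functional, or a preimage under a
further multiplication, can be inserted. -/
theorem span_mul_mem {S : Set (List ι)} {A B : List ι} {T : Submodule F (FreeAlgebra F ι)}
    (h : ∀ u ∈ S, word F A * word F u * word F B ∈ T) {z : FreeAlgebra F ι}
    (hz : z ∈ Submodule.span F (word F '' S)) : word F A * z * word F B ∈ T := by
  induction hz using Submodule.span_induction with
  | mem x hx => obtain ⟨u, hu, rfl⟩ := hx; exact h u hu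
  | zero => simp
  | add x y _ _ hx hy => simpa [mul_add, add_mul] using add_mem hx hy
  | smul c x _ hx => simpa using Submodule.smul_mem _ c hx

variable [LinearOrder ι]

/-- All rules replace a word by a combination of smaller words. -/
def Decreasing (Rule : List ι → FreeAlgebra F ι → Prop) : Prop :=
  ∀ r t, Rule r t → t ∈ Submodule.span F (word F '' {u | WordLT u r})

/-- No left-hand side of a rule contains another one. -/
def InclusionFree (Rule : List ι → FreeAlgebra F ι → Prop) : Prop :=
  ∀ P r Q t t', Rule r t → Rule (P ++ r ++ Q) t' → P = [] ∧ Q = [] ∧ t = t'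

/-- The overlap ambiguities are resolvable relative to the order. -/
def OverlapsResolvable (Rule : List ι → FreeAlgebra F ι → Prop) : Prop :=
  ∀ P S Q t t', P ≠ [] → S ≠ [] → Q ≠ [] → Rule (P ++ S) t → Rule (S ++ Q) t' →
    t * word F Q - word F P * t' ∈ relSpan Rule {u | WordLT u (P ++ S ++ Q)}

/-- Both reductions lead to `A t D t' B`. The two connecting differences, `t D (r' - t')` and `(r -
t) D t'` in context, only involve relations at words below `w`, because `t` lies below `r` and `t'`
below `r'`. -/
theorem disjoint_mem_relSpan (hd : Decreasing Rule) {A r D r' B w : List ι}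
    {t t' : FreeAlgebra F ι} (hr : Rule r t) (hr' : Rule r' t')
    (hw : w = A ++ r ++ D ++ r' ++ B) :
    word F A * t * word F (D ++ r' ++ B) - word F (A ++ r ++ D) * t' * word F B ∈
      relSpan Rule {u | WordLT u w} := by
  have h1 : word F A * t * (word F D * (word F r' - t') * word F B) ∈
      relSpan Rule {u | WordLT u w} := by
    have := span_mul_mem (A := A) (B := []) (S := {u | WordLT u r})
      (T := (relSpan Rule {u | WordLT u w}).comap
        (LinearMap.mulRight F (word F D * (word F r' - t') * word F B))) (fun u hu => ?_) (hd r t hr)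
    · simpa [mul_assoc] using this
    · have h := mem_relSpan (S := {u | WordLT u w}) (A := A ++ u ++ D) (B := B) hr' (by
        rw [hw]
        have := WordLT.context (u := u) (v := r) hu A (D ++ r' ++ B)
        simpa using this)
      simpa [word_append, mul_assoc] using h
  have h2 : (word F A * (word F r - t) * word F D) * t' * word F B ∈
      relSpan Rule {u | WordLT u w} := by
    have := span_mul_mem (A := []) (B := B) (S := {u | WordLT u r'})
      (T := (relSpan Rule {u | WordLT u w}).comap
        (LinearMap.mulLeft F (word F A * (word F r - t) * word F D))) (fun u hu => ?_)
        (hd r' t' hr')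
    · simpa [mul_assoc] using this
    · have h := mem_relSpan (S := {u | WordLT u w}) (A := A) (B := D ++ u ++ B) hr (by
        rw [hw]
        have := WordLT.context (u := u) (v := r') hu (A ++ r ++ D) B
        simpa using this)
      simpa [word_append, mul_assoc] using h
  have := sub_mem h1 h2
  convert this using 1
  simp only [word_append]
  noncomm_ring

/-- Here `r'` starts no earlier than `r`. Either the two occurrences are disjoint and their
reductions commute, or one contains the other and `InclusionFree` makes them equal, or they share a
proper overlap `S`, whose resolution is put in the context `A`, `B'`. -/
theorem confluent_of_append (hd : Decreasing Rule) (hi : InclusionFree Rule)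
    (ho : OverlapsResolvable Rule) {A r B C r' B' : List ι} {t t' : FreeAlgebra F ι}
    (hr : Rule r t) (hr' : Rule r' t') (h : r ++ B = C ++ (r' ++ B')) :
    word F A * t * word F B - word F (A ++ C) * t' * word F B' ∈
      relSpan Rule {u | WordLT u (A ++ r ++ B)} := by
  rcases List.append_eq_append_iff.1 h with ⟨D, rfl, rfl⟩ | ⟨S, rfl, h2⟩
  · have := disjoint_mem_relSpan hd (A := A) (D := D) (B := B') hr hr' rfl
    simpa [List.append_assoc] using this
  rcases eq_or_ne S [] with rfl | hS
  · have := disjoint_mem_relSpan hd (A := A) (D := []) (B := B') hr hr' rfl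
    simp only [List.nil_append] at h2
    subst h2
    simpa [List.append_assoc] using this
  rcases List.append_eq_append_iff.1 h2 with ⟨D, rfl, rfl⟩ | ⟨Q, rfl, rfl⟩
  · obtain ⟨rfl, rfl, rfl⟩ := hi C r' D t' t hr' (by simpa [List.append_assoc] using hr)
    simp
  rcases eq_or_ne C [] with rfl | hC
  · obtain ⟨-, rfl, rfl⟩ := hi [] S Q t t' (by simpa using hr) (by simpa using hr')
    simp
  rcases eq_or_ne Q [] with rfl | hQ
  · obtain ⟨rfl, -, rfl⟩ := hi C S [] t' t (by simpa using hr') (by simpa using hr)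
    simp
  have := word_mul_mem_relSpan (A := A) (B := B')
    (S' := {u | WordLT u (A ++ (C ++ S) ++ (Q ++ B'))})
    (fun u hu => by
      have := WordLT.context (u := u) (v := C ++ S ++ Q) hu A B'
      simpa [List.append_assoc] using this)
    (ho C S Q t t' hC hS hQ hr hr')
  convert this using 1
  simp only [word_append]
  noncomm_ring

theorem confluent (hd : Decreasing Rule) (hi : InclusionFree Rule)
    (ho : OverlapsResolvable Rule) {A r B A' r' B' w : List ι} {t t' : FreeAlgebra F ι}
    (hr : Rule r t) (hr' : Rule r' t') (h : w = A ++ r ++ B) (h' : w = A' ++ r' ++ B') :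
    word F A * t * word F B - word F A' * t' * word F B' ∈
      relSpan Rule {u | WordLT u w} := by
  have e := h.symm.trans h'
  rw [List.append_assoc, List.append_assoc] at e
  rcases List.append_eq_append_iff.1 e with ⟨C, rfl, e⟩ | ⟨C, rfl, e⟩
  · rw [h]
    exact confluent_of_append hd hi ho hr hr' (List.append_cancel_left (as := A) (by simpa using e))
  · rw [h', ← neg_sub]
    exact neg_mem (confluent_of_append hd hi ho hr' hr
      (List.append_cancel_left (as := A') (by simpa using e.symm)))

variable [WellFoundedLT ι]

theorem wordLT_wellFounded : WellFounded (WordLT (ι := ι)) :=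
  List.Shortlex.wf wellFounded_lt

/-- The diamond lemma: any function on the irreducible words extends to a functional that is
compatible with the rules. -/
theorem exists_functional_of_irreducible (hd : Decreasing Rule) (hi : InclusionFree Rule)
    (ho : OverlapsResolvable Rule) (f : List ι → F) :
    ∃ φ : FreeAlgebra F ι →ₗ[F] F, relSpan Rule Set.univ ≤ LinearMap.ker φ ∧
      ∀ w, IrredWord Rule w → φ (word F w) = f w := by
  classical
  let Red (w : List ι) (q : List ι × List ι × FreeAlgebra F ι × List ι) : Prop :=
    Rule q.2.1 q.2.2.1 ∧ w = q.1 ++ q.2.1 ++ q.2.2.2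
  let tgt (q : List ι × List ι × FreeAlgebra F ι × List ι) : FreeAlgebra F ι :=
    word F q.1 * q.2.2.1 * word F q.2.2.2
  -- Well-founded recursion: a reducible word takes the value of one chosen reduction, an
  -- irreducible one the prescribed value. The default `0` at words not below `w` is harmless, since
  -- the reduction lies in the span of words below `w`.
  let step (w : List ι) (rec : ∀ u, WordLT u w → F) : F :=
    if h : ∃ q, Red w q then
      (exists_functional_word fun u => if hu : WordLT u w then rec u hu else 0).choose
        (tgt h.choose)
    else f w
  let G : List ι → F := wordLT_wellFounded.fix step
  obtain ⟨φ, hφ⟩ := exists_functional_word G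
  have htgt : ∀ w q, Red w q → tgt q ∈ Submodule.span F (word F '' {u | WordLT u w}) := by
    rintro w ⟨A, r, t, B⟩ ⟨hr, rfl⟩
    refine span_mul_mem (fun u hu => ?_) (hd r t hr)
    exact Submodule.subset_span ⟨A ++ u ++ B, WordLT.context hu A B, by simp [word_append, mul_assoc]⟩
  have hfix : ∀ w, G w = step w fun u _ => G u := fun w => wordLT_wellFounded.fix_eq step w
  have hred : ∀ w (h : ∃ q, Red w q), φ (word F w) = φ (tgt h.choose) := by
    intro w h
    rw [hφ, hfix]
    simp only [step, dif_pos h]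
    set e := exists_functional_word fun u => if hu : WordLT u w then G u else 0
    have hs := e.choose_spec
    refine LinearMap.eqOn_span (f := e.choose) (g := φ) ?_ (htgt w _ h.choose_spec)
    rintro _ ⟨u, hu, rfl⟩
    rw [hs, hφ]
    exact if_pos hu
  refine ⟨φ, ?_, fun w hw => ?_⟩
  -- The value does not depend on the chosen reduction: by confluence any other one differs from it
  -- by relations at words below `w`, which the functional kills by induction.
  · have key : ∀ w, ∀ A r t B, Rule r t → A ++ r ++ B = w →
        φ (word F A * (word F r - t) * word F B) = 0 := by
      intro w
      refine WellFounded.induction wordLT_wellFounded (C := fun w => ∀ A r t B, Rule r t →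
        A ++ r ++ B = w → φ (word F A * (word F r - t) * word F B) = 0) w ?_
      intro w ih A r t B hr hw
      have hker : relSpan Rule {u | WordLT u w} ≤ LinearMap.ker φ := by
        refine Submodule.span_le.2 ?_
        rintro _ ⟨A', r', t', B', hr', hu, rfl⟩
        exact ih _ hu A' r' t' B' hr' rfl
      have hex : ∃ q, Red w q := ⟨(A, r, t, B), hr, hw.symm⟩
      have hc := hker (confluent hd hi ho hr hex.choose_spec.1 hw.symm hex.choose_spec.2)
      rw [LinearMap.mem_ker, map_sub, sub_eq_zero] at hc
      have := hred w hex
      rw [mul_sub, sub_mul, map_sub, ← word_append, ← word_append, hw, this, hc, sub_self]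
    refine Submodule.span_le.2 ?_
    rintro _ ⟨A, r, t, B, hr, -, rfl⟩
    exact key _ A r t B hr rfl
  · rw [hφ, hfix]
    refine dif_neg ?_
    rintro ⟨⟨A, r, t, B⟩, hr, h⟩
    exact hw A r t B hr h

/-- Modulo the rules, every word is a combination of irreducible words in any class of words that
is respected by the rules. -/
theorem word_mem_relSpan_sup_span (C : List ι → Set (List ι))
    (hC : ∀ w, w ∈ C w) (htrans : ∀ u v w, u ∈ C v → v ∈ C w → u ∈ C w)
    (hd : ∀ A r t B, Rule r t → word F A * t * word F B ∈
      Submodule.span F (word F '' {u | WordLT u (A ++ r ++ B) ∧ u ∈ C (A ++ r ++ B)}))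
    (w : List ι) : word F w ∈ relSpan Rule Set.univ ⊔
      Submodule.span F (word F '' {u | IrredWord Rule u ∧ u ∈ C w}) := by
  refine WellFounded.induction wordLT_wellFounded (C := fun w => word F w ∈
    relSpan Rule Set.univ ⊔ Submodule.span F (word F '' {u | IrredWord Rule u ∧ u ∈ C w})) w ?_
  intro w ih
  by_cases hw : IrredWord Rule w
  · exact Submodule.mem_sup_right (Submodule.subset_span ⟨w, ⟨hw, hC w⟩, rfl⟩)
  · simp only [IrredWord, not_forall, not_not] at hw
    obtain ⟨A, r, t, B, hr, rfl⟩ := hw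
    have h1 : word F A * (word F r - t) * word F B ∈ relSpan Rule Set.univ :=
      mem_relSpan hr (Set.mem_univ _)
    have h2 : word F A * t * word F B ∈ relSpan Rule Set.univ ⊔
        Submodule.span F (word F '' {u | IrredWord Rule u ∧ u ∈ C (A ++ r ++ B)}) := by
      refine Submodule.span_le.2 ?_ (hd A r t B hr)
      rintro _ ⟨u, ⟨hu, huC⟩, rfl⟩
      have hle := Submodule.span_mono (R := F) (Set.image_mono (f := word F)
        fun v (hv : IrredWord Rule v ∧ v ∈ C u) =>
          (⟨hv.1, htrans _ _ _ hv.2 huC⟩ : IrredWord Rule v ∧ v ∈ C (A ++ r ++ B)))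
      have h := sup_le_sup_left hle (relSpan Rule Set.univ)
      exact h (ih u hu)
    have := add_mem (Submodule.mem_sup_left h1) h2
    convert this using 1
    rw [word_append, word_append]
    noncomm_ring

end Rewriting

end FreeAlgebra

/-! ### Commutators in characteristic `p` and Jacobson's formula -/

/-- Consecutive entries of row `p - 1` of Pascal's triangle add up to an entry of row `p`, which is
divisible by `p`, so they alternate in sign. -/
theorem choose_prime_sub_one_cast {S : Type*} [Ring S] {p : ℕ} (hp : p.Prime) (h0 : (p : S) = 0)
    {k : ℕ} (hk : k < p) : ((p - 1).choose k : S) = (-1) ^ k := by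
  induction k with
  | zero => simp
  | succ k ih =>
    have h1 : p.choose (k + 1) = (p - 1).choose k + (p - 1).choose (k + 1) := by
      conv_lhs => rw [← Nat.sub_add_cancel hp.one_le]
      exact Nat.choose_succ_succ _ _
    have h2 : ((p.choose (k + 1) : ℕ) : S) = 0 := by
      obtain ⟨m, hm⟩ := hp.dvd_choose_self k.succ_ne_zero hk
      rw [hm, Nat.cast_mul, h0, zero_mul]
    rw [h1, Nat.cast_add, ih (by omega)] at h2
    rw [eq_neg_of_add_eq_zero_right h2, pow_succ]
    simp

theorem Commute.sub_pow_prime_sub_one {S : Type*} [Ring S] {p : ℕ} (hp : p.Prime)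
    (h0 : (p : S) = 0) {x y : S} (h : Commute x y) :
    (x - y) ^ (p - 1) = ∑ k ∈ Finset.range p, x ^ k * y ^ (p - 1 - k) := by
  rw [sub_eq_add_neg, (h.neg_right).add_pow, Nat.sub_add_cancel hp.one_le]
  refine Finset.sum_congr rfl fun k hk => ?_
  have hk' : k ≤ p - 1 := by have := Finset.mem_range.1 hk; omega
  -- Read at `p - 1 - k`, the binomial coefficient has the same sign as the one in `(-y) ^ (p - 1 -
  -- k)`, and the two cancel.
  rw [← Nat.choose_symm hk', choose_prime_sub_one_cast hp h0 (by have := hp.pos; omega),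
    neg_pow y, ((Commute.neg_one_left (y ^ (p - 1 - k))).pow_left _).eq, mul_assoc, mul_assoc,
    ← mul_pow]
  · simp
  · exact Commute.refl _

/-- The commutator with `a` is the difference of left and right multiplication by `a`, which
commute. -/
theorem iterate_commutator_prime_sub_one {S : Type*} [Ring S] {p : ℕ} (hp : p.Prime)
    (h0 : (p : S) = 0) (a z : S) :
    (fun z => a * z - z * a)^[p - 1] z =
      ∑ k ∈ Finset.range p, a ^ k * z * a ^ (p - 1 - k) := by
  have h : Commute (LinearMap.mulLeft ℤ a) (LinearMap.mulRight ℤ a) := by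
    ext x
    simp [mul_assoc]
  have h0' : ((p : ℕ) : Module.End ℤ S) = 0 := by
    ext x
    rw [Module.End.natCast_apply, nsmul_eq_mul, h0, zero_mul, LinearMap.zero_apply]
  have := congrArg (fun T : Module.End ℤ S => T z) (h.sub_pow_prime_sub_one hp h0')
  simp only [Module.End.pow_apply, LinearMap.sum_apply] at this
  calc _ = (⇑(LinearMap.mulLeft ℤ a - LinearMap.mulRight ℤ a))^[p - 1] z := by
        congr 1
    _ = _ := by
        rw [this]
        refine Finset.sum_congr rfl fun k _ => ?_
        simp [LinearMap.pow_mulLeft, LinearMap.pow_mulRight, mul_assoc]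

namespace Polynomial

variable {S : Type*} [Ring S]

theorem derivative_pow_eq_sum (Z : S[X]) (n : ℕ) :
    derivative (Z ^ n) = ∑ k ∈ Finset.range n, Z ^ k * derivative Z * Z ^ (n - 1 - k) := by
  induction n with
  | zero => simp
  | succ n ih =>
    rw [pow_succ, derivative_mul, ih, Finset.sum_range_succ, Finset.sum_mul]
    congr 1
    · refine Finset.sum_congr rfl fun k hk => ?_
      have hk := Finset.mem_range.1 hk
      rw [mul_assoc, ← pow_succ]
      congr 2
      omega
    · simp

/-- The variable is central, so evaluation at `1` and at `0` respects powers. The extreme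
coefficients of `(x X + y) ^ p` are `y ^ p` and `x ^ p`, and evaluation at `1` adds all
coefficients. -/
theorem add_pow_eq_sum_coeff (x y : S) (p : ℕ) (hp : 0 < p) :
    (x + y) ^ p = x ^ p + y ^ p +
      ∑ i ∈ Finset.Icc 1 (p - 1), ((C x * X + C y) ^ p).coeff i := by
  set Z : S[X] := C x * X + C y with hZ
  have hdeg : Z.natDegree ≤ 1 := natDegree_linear_le
  have h1 : (x + y) ^ p = eval 1 (Z ^ p) := by
    have := (eval₂RingHom' (RingHom.id S) 1 (fun a => Commute.one_right _)).map_pow Z p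
    change eval₂ _ _ _ = (eval₂ _ _ _) ^ p at this
    rw [eval, this, hZ]
    simp [eval₂_add, eval₂_mul_X]
  have h0 : y ^ p = (Z ^ p).coeff 0 := by
    have := (eval₂RingHom' (RingHom.id S) 0 (fun a => Commute.zero_right _)).map_pow Z p
    change eval₂ _ _ _ = (eval₂ _ _ _) ^ p at this
    rw [coeff_zero_eq_eval_zero, eval, this, hZ]
    simp [eval₂_add, eval₂_mul_X]
  have hp' : x ^ p = (Z ^ p).coeff p := by
    have := coeff_pow_of_natDegree_le hdeg (m := p)
    rw [mul_one] at this
    rw [this, hZ]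
    simp
  rw [h1, eval_eq_sum_range' (n := p + 1) (by
    have := natDegree_pow_le_of_le p hdeg
    omega), Finset.sum_range_succ, Finset.range_eq_Ico, Finset.sum_eq_sum_Ico_succ_bot hp, h0, hp']
  have : Finset.Icc 1 (p - 1) = Finset.Ico (0 + 1) p := by
    ext i; simp; omega
  rw [this]
  simp
  abel

end Polynomial

namespace LieSuperalgebra

variable {F V : Type*} [Field F] [AddCommGroup V] [Module F V] (g : LieSuperalgebra F V)

theorem adCoeff_mem {x y : V} (hx : x ∈ g.part 0) (hy : y ∈ g.part 0) (k j : ℕ) :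
    g.adCoeff x y k j ∈ g.part 0 := by
  induction k generalizing j with
  | zero =>
    cases j with
    | zero => exact hx
    | succ j => exact zero_mem _
  | succ k ih =>
    cases j with
    | zero => simpa [adCoeff] using g.bracket_mem hy (ih 0)
    | succ j =>
      rw [adCoeff]
      exact add_mem (by simpa using g.bracket_mem hx (ih j))
        (by simpa using g.bracket_mem hy (ih (j + 1)))

open Polynomial in
theorem map_adCoeff {S : Type*} [Ring S] [Algebra F S] (ψ : V →ₗ[F] S)
    (hψ : ∀ x ∈ g.part 0, ∀ y ∈ g.part 0, ψ (g.bracket x y) = ψ x * ψ y - ψ y * ψ x)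
    {x y : V} (hx : x ∈ g.part 0) (hy : y ∈ g.part 0) (k j : ℕ) :
    ψ (g.adCoeff x y k j) =
      ((fun z => (C (ψ x) * X + C (ψ y)) * z - z * (C (ψ x) * X + C (ψ y)))^[k]
        (C (ψ x))).coeff j := by
  induction k generalizing j with
  | zero => cases j <;> simp [adCoeff, coeff_C]
  | succ k ih =>
    rw [Function.iterate_succ_apply']
    cases j with
    | zero =>
      rw [adCoeff, hψ _ hy _ (g.adCoeff_mem hx hy k 0), ih]
      simp
    | succ j =>
      rw [adCoeff, map_add, hψ _ hx _ (g.adCoeff_mem hx hy k j),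
        hψ _ hy _ (g.adCoeff_mem hx hy k (j + 1)), ih, ih]
      simp only [mul_add, add_mul, coeff_sub, coeff_add, mul_assoc, coeff_C_mul, coeff_X_mul]
      simp only [← mul_assoc, coeff_mul_C, coeff_mul_X]
      abel

/-- Jacobson's formula for the `p`-th power of a sum. -/
theorem add_pow_eq_add_jacobsonS {p : ℕ} [Fact p.Prime] [CharP F p] {S : Type*} [Ring S]
    [Algebra F S] (ψ : V →ₗ[F] S)
    (hψ : ∀ x ∈ g.part 0, ∀ y ∈ g.part 0, ψ (g.bracket x y) = ψ x * ψ y - ψ y * ψ x)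
    {x y : V} (hx : x ∈ g.part 0) (hy : y ∈ g.part 0) :
    (ψ x + ψ y) ^ p = ψ x ^ p + ψ y ^ p +
      ψ (∑ i ∈ Finset.Icc 1 (p - 1), g.jacobsonS p x y i) := by
  have hp : p.Prime := Fact.out
  have h0 : (p : S) = 0 := by
    rw [← map_natCast (algebraMap F S), CharP.cast_eq_zero, map_zero]
  rw [Polynomial.add_pow_eq_sum_coeff _ _ p hp.pos, map_sum]
  congr 1
  refine Finset.sum_congr rfl fun i hi => ?_
  rw [Finset.mem_Icc] at hi
  obtain ⟨j, rfl⟩ : ∃ j, i = j + 1 := ⟨i - 1, by omega⟩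
  have hj : ((j + 1 : ℕ) : F) ≠ 0 := by
    rw [Ne, CharP.cast_eq_zero_iff F p]
    exact Nat.not_dvd_of_pos_of_lt (by omega) (by omega)
  have h0' : (p : Polynomial S) = 0 := by
    rw [← Polynomial.C_eq_natCast, h0, Polynomial.C_0]
  rw [jacobsonS, map_smul, g.map_adCoeff ψ hψ hx hy, iterate_commutator_prime_sub_one hp h0',
    eq_inv_smul_iff₀ hj]
  -- With `Z = x X + y`, the sum `∑ Z ^ k x Z ^ (p - 1 - k)` is both `(ad Z) ^ (p - 1) x` and the
  -- derivative of `Z ^ p`. Comparing coefficients of `X ^ j` produces the factor `j + 1`,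
  -- invertible because `j + 1 < p`.
  have hd : Polynomial.derivative (Polynomial.C (ψ x) * Polynomial.X + Polynomial.C (ψ y)) =
      Polynomial.C (ψ x) := by simp
  have := Polynomial.derivative_pow_eq_sum (Polynomial.C (ψ x) * Polynomial.X +
    Polynomial.C (ψ y)) p
  rw [hd] at this
  rw [← this, Polynomial.coeff_derivative, Nat.add_sub_cancel, Algebra.smul_def, map_natCast]
  rw [(Nat.cast_commute (j + 1) _).eq]
  push_cast
  rfl

end LieSuperalgebra

/-! ### Koszul signs -/

section KoszulSign

variable (F : Type*) [Field F]

@[simp]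
theorem koszulSign_zero_left (j : ZMod 2) : koszulSign F 0 j = 1 := by simp [koszulSign]

@[simp]
theorem koszulSign_zero_right (i : ZMod 2) : koszulSign F i 0 = 1 := by simp [koszulSign]

@[simp]
theorem koszulSign_one_one : koszulSign F 1 1 = -1 := by
  change (-1 : F) ^ (1 * 1) = -1
  simp

theorem zmod_two_eq_zero_or_one (i : ZMod 2) : i = 0 ∨ i = 1 := by
  revert i; decide

theorem koszulSign_comm (i j : ZMod 2) : koszulSign F i j = koszulSign F j i := by
  simp [koszulSign, mul_comm]

@[simp]
theorem koszulSign_mul_self (i j : ZMod 2) : koszulSign F i j * koszulSign F i j = 1 := by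
  rcases zmod_two_eq_zero_or_one i with rfl | rfl <;>
    rcases zmod_two_eq_zero_or_one j with rfl | rfl <;> simp

theorem koszulSign_add_left (i j k : ZMod 2) :
    koszulSign F (i + j) k = koszulSign F i k * koszulSign F j k := by
  have h : (1 + 1 : ZMod 2) = 0 := by decide
  rcases zmod_two_eq_zero_or_one i with rfl | rfl <;>
    rcases zmod_two_eq_zero_or_one j with rfl | rfl <;>
    rcases zmod_two_eq_zero_or_one k with rfl | rfl <;> simp [h]

theorem koszulSign_add_right (i j k : ZMod 2) :
    koszulSign F k (i + j) = koszulSign F k i * koszulSign F k j := by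
  simp only [koszulSign_comm F k, koszulSign_add_left]

theorem koszulSign_eq_one_or (i j : ZMod 2) : koszulSign F i j = 1 ∨ koszulSign F i j = -1 := by
  rcases zmod_two_eq_zero_or_one i with rfl | rfl <;>
    rcases zmod_two_eq_zero_or_one j with rfl | rfl <;> simp

end KoszulSign

/-! ### The rewriting system of a reduced enveloping algebra -/

/-- The sum telescopes. Keeping the sign `ε` general treats `p`-th powers of even letters and
squares of odd letters together. -/
theorem sum_twisted_commutator {F S : Type*} [Field F] [Ring S] [Algebra F S] (a b : S) (ε : F)
    (n : ℕ) :
    ∑ k ∈ Finset.range n, ε ^ (n - 1 - k) • (a ^ k * (a * b - ε • (b * a)) * a ^ (n - 1 - k)) =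
      a ^ n * b - ε ^ n • (b * a ^ n) := by
  induction n with
  | zero => simp
  | succ n ih =>
    rw [Finset.sum_range_succ]
    have h : ∑ k ∈ Finset.range n, ε ^ (n + 1 - 1 - k) •
        (a ^ k * (a * b - ε • (b * a)) * a ^ (n + 1 - 1 - k)) =
        ε • ((a ^ n * b - ε ^ n • (b * a ^ n)) * a) := by
      rw [← ih, Finset.sum_mul, Finset.smul_sum]
      refine Finset.sum_congr rfl fun k hk => ?_
      have hk := Finset.mem_range.1 hk
      rw [show n + 1 - 1 - k = n - 1 - k + 1 by omega, pow_succ, pow_succ, smul_mul_assoc, smul_smul,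
        mul_comm ε]
      simp only [mul_assoc]
    rw [h]
    simp only [Nat.add_sub_cancel, Nat.sub_self, pow_zero, one_smul, mul_one]
    simp only [mul_sub, sub_mul, smul_sub, mul_smul_comm, smul_mul_assoc, smul_smul, pow_succ,
      mul_assoc]
    rw [← mul_comm (ε ^ n) ε, ← mul_assoc (a ^ n) a b, ← pow_succ, pow_succ', mul_assoc]
    abel

/-- A homogeneous basis of a Lie superalgebra with, for each basis vector `e`, a relation
`e ^ height = target + const` compatible with the bracket; basis vectors of height one are
central and are to be killed. -/
structure LieSuperalgebra.HeightBasis {F V : Type*} [Field F] [AddCommGroup V] [Module F V]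
    (g : LieSuperalgebra F V) (p : ℕ) (ι : Type*) where
  /-- The underlying basis. -/
  basis : Module.Basis ι F V
  /-- The parity of a basis vector. -/
  parity : ι → ZMod 2
  basis_mem : ∀ i, basis i ∈ g.part (parity i)
  /-- The exponent of the power relation. -/
  height : ι → ℕ
  height_pos : ∀ i, 0 < height i
  height_even : ∀ i, parity i = 0 → height i = p
  height_odd : ∀ i, parity i = 1 → height i ≤ 2
  /-- The linear term of the power relation. -/
  target : ι → V
  /-- The constant term of the power relation. -/
  const : ι → F
  target_mem : ∀ i, target i ∈ g.part 0
  bracket_target : ∀ i, 2 ≤ height i → ∀ z,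
    g.bracket (target i) z = (g.bracket (basis i))^[height i] z
  -- For an odd vector `e` of height two this bracket is a multiple of the cube `[e, [e, e]]`,
  -- possibly nonzero in characteristic three. It need only vanish modulo the vectors that are
  -- killed.
  bracket_target_self : ∀ i,
    g.bracket (target i) (basis i) ∈ Submodule.span F (basis '' {k | height k = 1})
  height_two : ∀ i, parity i = 1 → height i = 2 →
    (2 : F) • target i = g.bracket (basis i) (basis i) ∧ const i = 0
  bracket_of_height_one : ∀ i, height i = 1 → ∀ z, g.bracket (basis i) z = 0
  target_of_height_one : ∀ i, height i = 1 → target i = 0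
  const_of_height_one : ∀ i, height i = 1 → const i = 0

namespace LieSuperalgebra.HeightBasis

open FreeAlgebra LieSuperalgebra

variable {F V : Type*} [Field F] [AddCommGroup V] [Module F V] {g : LieSuperalgebra F V}
  {p : ℕ} {ι : Type*} (d : g.HeightBasis p ι)

/-- The embedding of the Lie superalgebra in the free algebra on the basis. -/
noncomputable def lin : V →ₗ[F] FreeAlgebra F ι := d.basis.constr F fun i => word F [i]

@[simp]
theorem lin_basis (i : ι) : d.lin (d.basis i) = word F [i] := by simp [lin]

/-- The sign attached to two basis vectors. -/
def sgn (i j : ι) : F := koszulSign F (d.parity i) (d.parity j)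

theorem sgn_mul_self (i j : ι) : d.sgn i j * d.sgn i j = 1 := koszulSign_mul_self F _ _

theorem sgn_comm (i j : ι) : d.sgn i j = d.sgn j i := koszulSign_comm F _ _

/-- The right hand side of the power relation. -/
noncomputable def powTarget (i : ι) : FreeAlgebra F ι := d.lin (d.target i) + algebraMap F _ (d.const i)

/-- The right hand side of the commutation relation. -/
noncomputable def swapTarget (i j : ι) : FreeAlgebra F ι :=
  d.sgn i j • word F [j, i] + d.lin (g.bracket (d.basis i) (d.basis j))

theorem skew_basis (i j : ι) : g.bracket (d.basis i) (d.basis j) =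
    -(d.sgn i j • g.bracket (d.basis j) (d.basis i)) := g.skew (d.basis_mem i) (d.basis_mem j)

theorem bracket_of_height_one_right {j : ι} (h : d.height j = 1) (i : ι) :
    g.bracket (d.basis i) (d.basis j) = 0 := by
  rw [d.skew_basis, d.bracket_of_height_one j h, smul_zero, neg_zero]

/-- The full power of a letter is even, so it passes every other letter without a sign. -/
theorem sgn_pow_height {i : ι} (h : 2 ≤ d.height i) (j : ι) : d.sgn i j ^ d.height i = 1 := by
  rcases zmod_two_eq_zero_or_one (d.parity i) with h0 | h0
  · simp [sgn, h0]
  · have : d.height i = 2 := le_antisymm (d.height_odd i h0) h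
    rw [this, pow_two, d.sgn_mul_self]

theorem sgn_pow_height_sub_one {i : ι} (h : 2 ≤ d.height i) (j : ι) :
    d.sgn i j ^ (d.height i - 1) = d.sgn i j := by
  have h1 := d.sgn_pow_height h j
  rw [← Nat.sub_add_cancel (le_trans one_le_two h), pow_succ] at h1
  calc _ = d.sgn i j ^ (d.height i - 1) * (d.sgn i j * d.sgn i j) := by
        rw [d.sgn_mul_self, mul_one]
    _ = _ := by rw [← mul_assoc, h1, one_mul]

variable [LinearOrder ι]

/-- The rewriting rules: sort the letters, and reduce powers. -/
def Rule (r : List ι) (t : FreeAlgebra F ι) : Prop :=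
  -- A letter of height one is itself the left-hand side of a power rule, so a swap involving it
  -- would violate `InclusionFree`.
  (∃ i j, j < i ∧ 2 ≤ d.height i ∧ 2 ≤ d.height j ∧ r = [i, j] ∧ t = d.swapTarget i j) ∨
    ∃ i, r = List.replicate (d.height i) i ∧ t = d.powTarget i

theorem rule_swap {i j : ι} (h : j < i) (hi : 2 ≤ d.height i) (hj : 2 ≤ d.height j) :
    d.Rule [i, j] (d.swapTarget i j) := Or.inl ⟨i, j, h, hi, hj, rfl, rfl⟩

theorem rule_pow (i : ι) : d.Rule (List.replicate (d.height i) i) (d.powTarget i) :=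
  Or.inr ⟨i, rfl, rfl⟩

/-- The span of the relations of degree at most `n`. -/
def relLE (n : ℕ) : Submodule F (FreeAlgebra F ι) := relSpan d.Rule {u | u.length ≤ n}

theorem relLE_mono {m n : ℕ} (h : m ≤ n) : d.relLE m ≤ d.relLE n :=
  relSpan_mono fun _ hu => le_trans hu h

/-- Shorter words come first in the order, so relations of degree below the length of an ambiguity
may be used freely to resolve it. -/
theorem relLE_le_relSpan {n : ℕ} {w : List ι} (h : n < w.length) :
    d.relLE n ≤ relSpan d.Rule {u | WordLT u w} :=
  relSpan_mono fun _ hu => List.Shortlex.of_length_lt (lt_of_le_of_lt hu h)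

theorem word_mul_mem_relLE {m n : ℕ} {A B : List ι} {z : FreeAlgebra F ι} (hz : z ∈ d.relLE m)
    (h : A.length + m + B.length ≤ n) : word F A * z * word F B ∈ d.relLE n :=
  word_mul_mem_relSpan (fun u (hu : u.length ≤ m) => by
    simp only [Set.mem_ofPred_eq, List.length_append]; omega) hz

variable [Fintype ι]

omit [LinearOrder ι] in
theorem lin_eq_sum (x : V) : d.lin x = ∑ i, d.basis.repr x i • word F [i] := by
  conv_lhs => rw [← d.basis.sum_repr x, map_sum]
  simp only [map_smul, lin_basis]

theorem lin_mul_mem {m n : ℕ} {z : FreeAlgebra F ι} (hz : z ∈ d.relLE m) (h : m + 1 ≤ n) (x : V) :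
    d.lin x * z ∈ d.relLE n := by
  rw [d.lin_eq_sum, Finset.sum_mul]
  refine sum_mem fun i _ => ?_
  rw [smul_mul_assoc]
  refine Submodule.smul_mem _ _ ?_
  simpa using d.word_mul_mem_relLE (A := [i]) (B := []) hz (by simp; omega)

theorem mul_lin_mem {m n : ℕ} {z : FreeAlgebra F ι} (hz : z ∈ d.relLE m) (h : m + 1 ≤ n) (x : V) :
    z * d.lin x ∈ d.relLE n := by
  rw [d.lin_eq_sum, Finset.mul_sum]
  refine sum_mem fun i _ => ?_
  rw [mul_smul_comm]
  refine Submodule.smul_mem _ _ ?_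
  simpa using d.word_mul_mem_relLE (A := []) (B := [i]) hz (by simp; omega)

omit [Fintype ι] in
theorem word_sub_powTarget_mem (i : ι) :
    word F (List.replicate (d.height i) i) - d.powTarget i ∈ d.relLE (d.height i) := by
  simpa [relLE] using mem_relSpan (A := []) (B := []) (d.rule_pow i)
    (show _ ∈ {u : List ι | u.length ≤ d.height i} by simp)

omit [Fintype ι] in
theorem word_mem_of_height_one {i : ι} (h : d.height i = 1) : word F [i] ∈ d.relLE 1 := by
  have := d.word_sub_powTarget_mem i
  simpa [powTarget, h, d.target_of_height_one i h, d.const_of_height_one i h] using this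

theorem lin_mem_of_mem_span {x : V}
    (hx : x ∈ Submodule.span F (d.basis '' {k | d.height k = 1})) : d.lin x ∈ d.relLE 1 := by
  induction hx using Submodule.span_induction with
  | mem x hx => obtain ⟨k, hk, rfl⟩ := hx; simpa using d.word_mem_of_height_one hk
  | zero => simp
  | add x y _ _ hx hy => simpa using add_mem hx hy
  | smul c x _ hx => simpa using Submodule.smul_mem _ c hx

omit [Fintype ι] in
theorem swap_mem {i j : ι} (h : j < i) (hi : 2 ≤ d.height i) (hj : 2 ≤ d.height j) :
    word F [i] * word F [j] - d.sgn i j • (word F [j] * word F [i]) -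
      d.lin (g.bracket (d.basis i) (d.basis j)) ∈ d.relLE 2 := by
  have := mem_relSpan (A := []) (B := []) (d.rule_swap h hi hj)
    (show _ ∈ {u : List ι | u.length ≤ 2} by simp)
  simpa [relLE, swapTarget, word_cons i [j], word_cons j [i], sub_sub] using this

/-- Basis vectors commute up to the bracket. -/
theorem comm_basis (h2 : (2 : F) ≠ 0) (i j : ι) :
    word F [i] * word F [j] - d.sgn i j • (word F [j] * word F [i]) -
      d.lin (g.bracket (d.basis i) (d.basis j)) ∈ d.relLE 2 := by
  by_cases hi : d.height i = 1
  · have h1 := d.word_mem_of_height_one hi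
    rw [d.bracket_of_height_one i hi, map_zero, sub_zero, ← d.lin_basis j]
    exact sub_mem (d.mul_lin_mem h1 le_rfl _) (Submodule.smul_mem _ _ (d.lin_mul_mem h1 le_rfl _))
  by_cases hj : d.height j = 1
  · have h1 := d.word_mem_of_height_one hj
    rw [d.bracket_of_height_one_right hj, map_zero, sub_zero, ← d.lin_basis i]
    exact sub_mem (d.lin_mul_mem h1 le_rfl _) (Submodule.smul_mem _ _ (d.mul_lin_mem h1 le_rfl _))
  have hi' : 2 ≤ d.height i := by have := d.height_pos i; omega
  have hj' : 2 ≤ d.height j := by have := d.height_pos j; omega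
  rcases lt_trichotomy j i with h | rfl | h
  · exact d.swap_mem h hi' hj'
  · rcases zmod_two_eq_zero_or_one (d.parity j) with h0 | h0
    · have hb := d.skew_basis j j
      have hs : d.sgn j j = 1 := by simp [sgn, h0]
      rw [hs, one_smul, eq_neg_iff_add_eq_zero, ← two_smul F, smul_eq_zero] at hb
      rw [hs, hb.resolve_left h2]
      simp
    -- For an odd vector of height two the relation is twice the power relation.
    · have hs : d.sgn j j = -1 := by simp [sgn, h0]
      have hh : d.height j = 2 := le_antisymm (d.height_odd j h0) hj'
      have := d.word_sub_powTarget_mem j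
      rw [hh, word_replicate] at this
      rw [← (d.height_two j h0 hh).1, hs]
      have := Submodule.smul_mem _ (2 : F) this
      rw [powTarget, (d.height_two j h0 hh).2, map_zero, add_zero, smul_sub, ← map_smul] at this
      convert this using 2
      rw [two_smul, neg_one_smul, sub_neg_eq_add, pow_two]
  · have := Submodule.smul_mem _ (-d.sgn i j) (d.swap_mem h hj' hi')
    convert this using 1
    rw [d.skew_basis i j, d.sgn_comm j i]
    simp only [smul_sub, neg_smul, smul_smul, neg_mul, d.sgn_mul_self, map_neg, map_smul, one_smul]
    abel

end LieSuperalgebra.HeightBasis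

/-! ### Parity of words, commutation relations, resolution of the ambiguities -/

namespace LieSuperalgebra.HeightBasis

open FreeAlgebra LieSuperalgebra

variable {F V : Type*} [Field F] [AddCommGroup V] [Module F V] {g : LieSuperalgebra F V}
  {p : ℕ} {ι : Type*} (d : g.HeightBasis p ι)

theorem part_le_span [Fintype ι] (i : ZMod 2) :
    g.part i ≤ Submodule.span F (d.basis '' {k | d.parity k = i}) := by
  classical
  intro x hx
  set y := ∑ k with d.parity k = i, d.basis.repr x k • d.basis k with hy
  have hyi : y ∈ g.part i := sum_mem fun k hk =>
    Submodule.smul_mem _ _ ((Finset.mem_filter.1 hk).2 ▸ d.basis_mem k)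
  have hxy : x - y ∈ g.part (i + 1) := by
    have : x - y = ∑ k with ¬ d.parity k = i, d.basis.repr x k • d.basis k := by
      rw [sub_eq_iff_eq_add', hy, Finset.sum_filter_add_sum_filter_not, d.basis.sum_repr]
    rw [this]
    refine sum_mem fun k hk => Submodule.smul_mem _ _ ?_
    have h1 : d.parity k = i + 1 := by
      have := (Finset.mem_filter.1 hk).2
      generalize d.parity k = j at this
      clear * - this
      revert i j; decide
    exact h1 ▸ d.basis_mem k
  have hdis : Disjoint (g.part i) (g.part (i + 1)) :=
    g.isInternal.submodule_iSupIndep.pairwiseDisjoint (by clear * -; revert i; decide)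
  have h0 := Submodule.disjoint_def.1 hdis _ (sub_mem hx hyi) hxy
  rw [sub_eq_zero.1 h0]
  exact sum_mem fun k hk => Submodule.smul_mem _ _
    (Submodule.subset_span ⟨k, (Finset.mem_filter.1 hk).2, rfl⟩)

/-- The parity of a word. -/
def wordParity (w : List ι) : ZMod 2 := (w.map d.parity).sum

@[simp]
theorem wordParity_nil : d.wordParity [] = 0 := rfl

@[simp]
theorem wordParity_cons (i : ι) (w : List ι) :
    d.wordParity (i :: w) = d.parity i + d.wordParity w := by simp [wordParity]

@[simp]
theorem wordParity_append (u w : List ι) :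
    d.wordParity (u ++ w) = d.wordParity u + d.wordParity w := by simp [wordParity]

theorem lin_mem_span [Fintype ι] {i : ZMod 2} {x : V} (hx : x ∈ g.part i) :
    d.lin x ∈ Submodule.span F (word F '' {u | u.length = 1 ∧ d.wordParity u = i}) := by
  have := Submodule.mem_map_of_mem (f := d.lin) (d.part_le_span i hx)
  rw [Submodule.map_span] at this
  refine Submodule.span_mono ?_ this
  rintro _ ⟨_, ⟨k, hk, rfl⟩, rfl⟩
  exact ⟨[k], ⟨rfl, by simpa using hk⟩, by simp⟩

section Fintype

variable [LinearOrder ι] [Fintype ι]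

/-- Besides decreasing words, the rules preserve parity: the bracket is graded, and the full power
of a letter of height at least two is even, like its target and the constants. -/
theorem target_mem_span {r : List ι} {t : FreeAlgebra F ι} (hr : d.Rule r t) :
    t ∈ Submodule.span F (word F '' {u | WordLT u r ∧ d.wordParity u = d.wordParity r}) := by
  rcases hr with ⟨i, j, h, -, -, rfl, rfl⟩ | ⟨i, rfl, rfl⟩
  · refine add_mem (Submodule.smul_mem _ _ (Submodule.subset_span ⟨[j, i], ⟨?_, ?_⟩, rfl⟩)) ?_
    · exact wordLT_of_lt (u := [i]) (v := [j]) h rfl []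
    · simp [add_comm]
    · refine Submodule.span_mono (Set.image_mono ?_)
        (d.lin_mem_span (g.bracket_mem (d.basis_mem i) (d.basis_mem j)))
      rintro u ⟨h1, h2⟩
      exact ⟨List.Shortlex.of_length_lt (by simp [h1]), by simp [h2]⟩
  · by_cases h1 : d.height i = 1
    · simp [powTarget, d.target_of_height_one i h1, d.const_of_height_one i h1]
    have h2 : 2 ≤ d.height i := by have := d.height_pos i; omega
    have hpar : d.wordParity (List.replicate (d.height i) i) = 0 := by
      rcases zmod_two_eq_zero_or_one (d.parity i) with h0 | h0
      · simp [wordParity, h0]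
      · rw [le_antisymm (d.height_odd i h0) h2]
        simp [wordParity, h0]
        decide
    refine add_mem ?_ ?_
    · refine Submodule.span_mono (Set.image_mono ?_) (d.lin_mem_span (d.target_mem i))
      rintro u ⟨h1, h2⟩
      exact ⟨List.Shortlex.of_length_lt (by simp; omega), by rw [h2, hpar]⟩
    · rw [Algebra.algebraMap_eq_smul_one]
      refine Submodule.smul_mem _ _ (Submodule.subset_span ⟨[], ⟨?_, hpar.symm⟩, rfl⟩)
      exact List.Shortlex.of_length_lt (by simp; omega)

theorem decreasing : Decreasing d.Rule := fun _ _ hr =>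
  Submodule.span_mono (Set.image_mono fun _ h => h.1) (d.target_mem_span hr)

omit [Fintype ι] in
-- A swap has two distinct letters, so it does not fit in a constant word. A constant word inside a
-- swap would have length one, which the height conditions on swaps exclude.
theorem inclusionFree : InclusionFree d.Rule := by
  rintro P r Q t t' (⟨i, j, hji, hi, hj, rfl, rfl⟩ | ⟨i, rfl, rfl⟩)
    (⟨k, l, hlk, hk, hl, h, rfl⟩ | ⟨k, h, rfl⟩)
  · have hlen := congrArg List.length h
    simp only [List.length_append, List.length_cons, List.length_nil] at hlen
    obtain rfl : P = [] := List.eq_nil_of_length_eq_zero (by omega)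
    obtain rfl : Q = [] := List.eq_nil_of_length_eq_zero (by omega)
    simp at h
    simp [h]
  · have h1 : i ∈ List.replicate (d.height k) k := h ▸ by simp
    have h2 : j ∈ List.replicate (d.height k) k := h ▸ by simp
    rw [List.eq_of_mem_replicate h1, List.eq_of_mem_replicate h2] at hji
    exact absurd hji (lt_irrefl _)
  · have hi0 := d.height_pos i
    have h1 : i ∈ [k, l] := h ▸ by simp [hi0.ne']
    have hi2 : 2 ≤ d.height i := by
      simp only [List.mem_cons, List.not_mem_nil, or_false] at h1
      rcases h1 with rfl | rfl <;> assumption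
    have hlen := congrArg List.length h
    simp only [List.length_append, List.length_cons, List.length_nil, List.length_replicate] at hlen
    obtain rfl : P = [] := List.eq_nil_of_length_eq_zero (by omega)
    obtain rfl : Q = [] := List.eq_nil_of_length_eq_zero (by omega)
    have h2 : d.height i = 2 := by simpa using hlen
    rw [h2] at h
    simp [List.replicate_succ] at h
    exact absurd (h.1 ▸ h.2 ▸ hlk) (lt_irrefl _)
  · have hi0 := d.height_pos i
    have h1 : i ∈ List.replicate (d.height k) k := h ▸ by simp [hi0.ne']
    obtain rfl := List.eq_of_mem_replicate h1
    have hlen := congrArg List.length h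
    simp only [List.length_append, List.length_replicate] at hlen
    exact ⟨List.eq_nil_of_length_eq_zero (by omega), List.eq_nil_of_length_eq_zero (by omega), rfl⟩

/-- Homogeneous elements commute up to the bracket. -/
theorem comm_mem (h2 : (2 : F) ≠ 0) {i j : ZMod 2} {x y : V} (hx : x ∈ g.part i)
    (hy : y ∈ g.part j) :
    d.lin x * d.lin y - koszulSign F i j • (d.lin y * d.lin x) - d.lin (g.bracket x y) ∈
      d.relLE 2 := by
  replace hx := d.part_le_span i hx
  induction hx using Submodule.span_induction with
  | zero => simp
  | add x x' _ _ hx hx' =>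
    convert add_mem hx hx' using 1
    simp only [map_add, add_mul, mul_add, smul_add, LinearMap.add_apply]
    abel
  | smul c x _ hx =>
    convert Submodule.smul_mem _ c hx using 1
    simp only [map_smul, smul_mul_assoc, mul_smul_comm, smul_sub, LinearMap.smul_apply]
    rw [smul_comm c]
  | mem x hx =>
    obtain ⟨k, rfl, rfl⟩ := hx
    replace hy := d.part_le_span j hy
    induction hy using Submodule.span_induction with
    | zero => simp
    | add x x' _ _ hx hx' =>
      convert add_mem hx hx' using 1
      simp only [map_add, add_mul, mul_add, smul_add]
      abel
    | smul c x _ hx =>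
      convert Submodule.smul_mem _ c hx using 1
      simp only [map_smul, smul_mul_assoc, mul_smul_comm, smul_sub]
      rw [smul_comm c]
    | mem y hy =>
      obtain ⟨l, rfl, rfl⟩ := hy
      simpa [sgn] using d.comm_basis h2 k l

theorem comm_mem_of_even_left (h2 : (2 : F) ≠ 0) {x : V} (hx : x ∈ g.part 0) (j : ι) :
    d.lin x * word F [j] - word F [j] * d.lin x - d.lin (g.bracket x (d.basis j)) ∈
      d.relLE 2 := by
  simpa using d.comm_mem h2 hx (d.basis_mem j)

theorem comm_mem_of_even (h2 : (2 : F) ≠ 0) {x : V} (hx : x ∈ g.part 0) (y : V) :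
    d.lin x * d.lin y - d.lin y * d.lin x - d.lin (g.bracket x y) ∈ d.relLE 2 := by
  have hy := d.basis.mem_span y
  induction hy using Submodule.span_induction with
  | zero => simp
  | add x x' _ _ hx hx' =>
    convert add_mem hx hx' using 1
    simp only [map_add, add_mul, mul_add]
    abel
  | smul c x _ hx =>
    convert Submodule.smul_mem _ c hx using 1
    simp only [map_smul, smul_mul_assoc, mul_smul_comm, smul_sub]
  | mem y hy =>
    obtain ⟨j, rfl⟩ := hy
    simpa using d.comm_mem_of_even_left h2 hx j

theorem commutator_mem {m n : ℕ} {z : FreeAlgebra F ι} (hz : z ∈ d.relLE m) (h : m + 1 ≤ n)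
    (i : ι) : word F [i] * z - z * word F [i] ∈ d.relLE n := by
  rw [← d.lin_basis]
  exact sub_mem (d.lin_mul_mem hz h _) (d.mul_lin_mem hz h _)

/-- The degree bound matters: for `m = p - 1` the error has degree at most `p`, one less than the
length of the ambiguity between a `p`-th power and a swap. -/
theorem iterate_commutator_mem (h2 : (2 : F) ≠ 0) {i : ι} (hi : d.parity i = 0) (x : V) (m : ℕ) :
    (fun z => word F [i] * z - z * word F [i])^[m] (d.lin x) -
      d.lin ((g.bracket (d.basis i))^[m] x) ∈ d.relLE (m + 1) := by
  induction m with
  | zero => simp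
  | succ m ih =>
    rw [Function.iterate_succ_apply', Function.iterate_succ_apply']
    have h1 := d.commutator_mem ih le_rfl i
    have h3 := d.relLE_mono (show 2 ≤ m + 1 + 1 by omega) (d.comm_mem_of_even h2
      (hi ▸ d.basis_mem i) ((g.bracket (d.basis i))^[m] x))
    convert add_mem h1 h3 using 1
    simp only [lin_basis, mul_sub, sub_mul]
    abel

variable [Fact p.Prime] [CharP F p]

/-- The iterated bracket with a basis vector, in terms of its powers. -/
theorem twisted_sum_mem (h2 : (2 : F) ≠ 0) {i : ι} (hi : 2 ≤ d.height i) (j : ι) :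
    ∑ k ∈ Finset.range (d.height i), d.sgn i j ^ (d.height i - 1 - k) •
        (word F [i] ^ k * d.lin (g.bracket (d.basis i) (d.basis j)) *
          word F [i] ^ (d.height i - 1 - k)) -
      (d.lin (d.target i) * word F [j] - word F [j] * d.lin (d.target i)) ∈
        d.relLE (d.height i) := by
  have hy := d.relLE_mono hi (d.comm_mem_of_even_left h2 (d.target_mem i) j)
  rw [d.bracket_target i hi] at hy
  rcases zmod_two_eq_zero_or_one (d.parity i) with h0 | h0
  -- Even case: the sum is the `(p - 1)`-fold commutator of `e_i` applied to `[e_i, e_j]`, hence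
  -- `(ad e_i) ^ p e_j`, which is the bracket of the target with `e_j`.
  · have hN := d.height_even i h0
    have hp : p.Prime := Fact.out
    have hs : d.sgn i j = 1 := by simp [sgn, h0]
    have hS : (p : FreeAlgebra F ι) = 0 := by
      rw [← map_natCast (algebraMap F (FreeAlgebra F ι)), CharP.cast_eq_zero, map_zero]
    have h1 := d.iterate_commutator_mem h2 h0 (g.bracket (d.basis i) (d.basis j)) (p - 1)
    rw [iterate_commutator_prime_sub_one hp hS, ← Function.iterate_succ_apply, Nat.succ_eq_add_one,
      Nat.sub_add_cancel hp.one_le] at h1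
    rw [hN] at hy ⊢
    simp only [hs, one_pow, one_smul]
    convert sub_mem h1 hy using 1
    abel
  -- Odd case: the two terms form the supercommutator of `e_i` with `[e_i, e_j]`, and `[e_i, [e_i,
  -- e_j]]` is again the bracket of the target with `e_j`.
  · have hN : d.height i = 2 := le_antisymm (d.height_odd i h0) hi
    have h1 := d.comm_mem h2 (d.basis_mem i) (g.bracket_mem (d.basis_mem i) (d.basis_mem j))
    rw [koszulSign_add_right] at h1
    have hs : koszulSign F (d.parity i) (d.parity i) = -1 := by simp [h0]
    rw [hs, neg_one_mul] at h1
    rw [hN] at hy ⊢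
    simp only [Function.iterate_succ_apply, Function.iterate_zero_apply] at hy
    convert sub_mem h1 hy using 1
    simp [Finset.sum_range_succ, sgn]
    abel

omit [LinearOrder ι] [Fintype ι] in
theorem lin_add_algebraMap_mul_sub (y b : FreeAlgebra F ι) (c : F) :
    (y + algebraMap F _ c) * b - b * (y + algebraMap F _ c) = y * b - b * y := by
  rw [add_mul, mul_add, Algebra.commutes]
  abel

/-- With `a = e_i`, `b = e_j` and `N` the height of `e_i`, expand `a ^ N b - b a ^ N` into twisted
commutators. The swap relation `E` occurs in them as `a ^ k E a ^ (N - 1 - k)`: for `k < N - 1` it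
sits at a word below `a ^ N b`, and for `k = N - 1` it is the reduction being compared. The bracket
terms add up to the commutator of the target with `b` by `twisted_sum_mem`, and the power rule
applies in `b a ^ N`, a smaller word. -/
theorem overlap_pow_swap (h2 : (2 : F) ≠ 0) {i j : ι} (hji : j < i) (hi : 2 ≤ d.height i)
    (hj : 2 ≤ d.height j) {w : List ι} (hw : w = List.replicate (d.height i) i ++ [j]) :
    d.powTarget i * word F [j] - word F [i] ^ (d.height i - 1) * d.swapTarget i j ∈
      relSpan d.Rule {u | WordLT u w} := by
  set N := d.height i with hN
  set I := relSpan d.Rule {u | WordLT u w} with hI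
  set a := word F [i]
  set b := word F [j]
  set E := a * b - d.swapTarget i j with hE
  have hlen : w.length = N + 1 := by simp [hw]
  have hterm : ∀ k < N - 1, a ^ k * E * a ^ (N - 1 - k) ∈ I := by
    intro k hk
    have := mem_relSpan (S := {u | WordLT u w}) (A := List.replicate k i)
      (B := List.replicate (N - 1 - k) i) (d.rule_swap hji hi hj) (by
        have h := wordLT_of_lt (u := List.replicate (N - 1 - k) i)
          (v := List.replicate (N - 1 - k - 1) i ++ [j]) hji (by simp; omega)
          (List.replicate (k + 1) i)
        rw [Set.mem_ofPred_eq, hw]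
        convert h using 1
        · simp [List.replicate_succ']
        · rw [← List.cons_append, ← List.replicate_succ, ← List.append_assoc,
            ← List.replicate_add]
          congr 2
          omega)
    rw [word_replicate, word_replicate, word_cons i [j]] at this
    exact this
  have hD : a * b - d.sgn i j • (b * a) = E + d.lin (g.bracket (d.basis i) (d.basis j)) := by
    rw [hE, swapTarget, word_cons j [i]]
    abel
  clear_value E
  have hsum := sum_twisted_commutator a b (d.sgn i j) N
  rw [hD, d.sgn_pow_height hi, one_smul] at hsum
  simp only [mul_add, add_mul, smul_add, Finset.sum_add_distrib] at hsum
  have hlast : ∑ k ∈ Finset.range N, d.sgn i j ^ (N - 1 - k) • (a ^ k * E * a ^ (N - 1 - k)) =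
      ∑ k ∈ Finset.range (N - 1), d.sgn i j ^ (N - 1 - k) • (a ^ k * E * a ^ (N - 1 - k)) +
        a ^ (N - 1) * E := by
    conv_lhs => rw [← Nat.sub_add_cancel (le_trans one_le_two hi), Finset.sum_range_succ]
    simp
  have h1 : ∑ k ∈ Finset.range (N - 1), d.sgn i j ^ (N - 1 - k) •
      (a ^ k * E * a ^ (N - 1 - k)) ∈ I :=
    sum_mem fun k hk => Submodule.smul_mem _ _ (hterm k (Finset.mem_range.1 hk))
  have h3 := d.relLE_le_relSpan (w := w) (by omega) (d.twisted_sum_mem h2 hi j)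
  have h4 : b * (a ^ N - d.powTarget i) ∈ I := by
    have := mem_relSpan (S := {u | WordLT u w}) (A := [j]) (B := []) (d.rule_pow i) (by
        have h := wordLT_of_lt (u := List.replicate N i)
          (v := List.replicate (N - 1) i ++ [j]) hji (by simp; omega) []
        rw [Set.mem_ofPred_eq, hw]
        convert h using 1
        · simp [hN]
        · rw [List.nil_append, ← List.cons_append, ← List.replicate_succ]
          congr 2
          omega)
    rw [word_replicate] at this
    simpa using this
  have h5 := lin_add_algebraMap_mul_sub (d.lin (d.target i)) b (d.const i)
  have h6 : a ^ (N - 1) * (a * b) = a ^ N * b := by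
    rw [← mul_assoc, ← pow_succ, Nat.sub_add_cancel (le_trans one_le_two hi)]
  have h7 : d.swapTarget i j = a * b - E := by rw [hE]; abel
  rw [h7, mul_sub, h6]
  rw [hlast] at hsum
  have := neg_mem (add_mem (add_mem h1 h3) h4)
  convert this using 1
  rw [← h5, mul_sub b, powTarget]
  rw [eq_sub_iff_add_eq] at hsum
  rw [← hsum]
  simp only [a, b, N]
  abel

/-- Mirror image of `overlap_pow_swap`: the swap relation now sits at the ambiguous word `b a ^ N`
in the term `k = 0`, and the power rule is applied in the smaller word `a ^ N b`. -/
theorem overlap_swap_pow (h2 : (2 : F) ≠ 0) {i j : ι} (hij : i < j) (hi : 2 ≤ d.height i)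
    (hj : 2 ≤ d.height j) {w : List ι} (hw : w = [j] ++ List.replicate (d.height i) i) :
    d.swapTarget j i * word F [i] ^ (d.height i - 1) - word F [j] * d.powTarget i ∈
      relSpan d.Rule {u | WordLT u w} := by
  set N := d.height i with hN
  set I := relSpan d.Rule {u | WordLT u w} with hI
  set a := word F [i]
  set b := word F [j]
  set E := b * a - d.swapTarget j i with hE
  have hlen : w.length = N + 1 := by simp [hw]
  have hterm : ∀ k < N - 1, a ^ (k + 1) * E * a ^ (N - 1 - (k + 1)) ∈ I := by
    intro k hk
    have := mem_relSpan (S := {u | WordLT u w}) (A := List.replicate (k + 1) i)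
      (B := List.replicate (N - 1 - (k + 1)) i) (d.rule_swap hij hj hi) (by
        have h := wordLT_of_lt (u := List.replicate k i ++ [j, i] ++
            List.replicate (N - 1 - (k + 1)) i)
          (v := List.replicate N i) hij (by simp; omega) []
        rw [Set.mem_ofPred_eq, hw]
        convert h using 1
        · simp [List.replicate_succ]
        · rfl)
    rw [word_replicate, word_replicate, word_cons j [i]] at this
    exact this
  have hD : a * b - d.sgn i j • (b * a) =
      -(d.sgn i j • E) + d.lin (g.bracket (d.basis i) (d.basis j)) := by
    rw [hE, swapTarget, word_cons i [j], d.skew_basis i j, d.sgn_comm j i]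
    simp only [smul_sub, smul_add, smul_smul, d.sgn_mul_self, one_smul, map_neg, map_smul]
    abel
  clear_value E
  have hsum := sum_twisted_commutator a b (d.sgn i j) N
  rw [hD, d.sgn_pow_height hi, one_smul] at hsum
  simp only [mul_add, add_mul, smul_add, Finset.sum_add_distrib] at hsum
  have hfirst : ∑ k ∈ Finset.range N, d.sgn i j ^ (N - 1 - k) •
        (a ^ k * -(d.sgn i j • E) * a ^ (N - 1 - k)) =
      -(d.sgn i j • ∑ k ∈ Finset.range (N - 1), d.sgn i j ^ (N - 1 - (k + 1)) •
        (a ^ (k + 1) * E * a ^ (N - 1 - (k + 1)))) - E * a ^ (N - 1) := by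
    conv_lhs => rw [← Nat.sub_add_cancel (le_trans one_le_two hi), Finset.sum_range_succ']
    simp only [Nat.add_sub_cancel, Nat.sub_zero, pow_zero, one_mul]
    rw [d.sgn_pow_height_sub_one hi, Finset.smul_sum, ← Finset.sum_neg_distrib, sub_eq_add_neg]
    congr 1
    · refine Finset.sum_congr rfl fun k _ => ?_
      simp only [mul_neg, neg_mul, smul_neg, mul_smul_comm, smul_mul_assoc]
      rw [smul_comm]
    · simp only [neg_mul, smul_neg, smul_mul_assoc, smul_smul, d.sgn_mul_self, one_smul]
  have h1 : ∑ k ∈ Finset.range (N - 1), d.sgn i j ^ (N - 1 - (k + 1)) •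
      (a ^ (k + 1) * E * a ^ (N - 1 - (k + 1))) ∈ I :=
    sum_mem fun k hk => Submodule.smul_mem _ _ (hterm k (Finset.mem_range.1 hk))
  have h3 := d.relLE_le_relSpan (w := w) (by omega) (d.twisted_sum_mem h2 hi j)
  have h4 : (a ^ N - d.powTarget i) * b ∈ I := by
    have := mem_relSpan (S := {u | WordLT u w}) (A := []) (B := [j]) (d.rule_pow i) (by
        have h := wordLT_of_lt (u := List.replicate (N - 1) i ++ [j])
          (v := List.replicate N i) hij (by simp; omega) []
        rw [Set.mem_ofPred_eq, hw]
        convert h using 1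
        · rw [List.nil_append, List.nil_append, ← List.cons_append, ← List.replicate_succ]
          congr 2
          omega
        · rfl)
    rw [word_replicate] at this
    simpa using this
  have h5 := lin_add_algebraMap_mul_sub (d.lin (d.target i)) b (d.const i)
  have h6 : b * a * a ^ (N - 1) = b * a ^ N := by
    rw [mul_assoc, ← pow_succ', Nat.sub_add_cancel (le_trans one_le_two hi)]
  have h7 : d.swapTarget j i = b * a - E := by rw [hE]; abel
  rw [h7, sub_mul, h6]
  rw [hfirst] at hsum
  have := add_mem (sub_mem (Submodule.smul_mem _ (d.sgn i j) h1) h3) h4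
  convert this using 1
  rw [← h5, sub_mul (a ^ N), powTarget]
  rw [eq_sub_iff_add_eq] at hsum
  rw [← hsum]
  simp only [a, b, N]
  abel

omit [Fact p.Prime] [CharP F p] in
-- The two reductions agree once the target commutes with `e_i` modulo relations of degree two.
-- Their bracket lies in the span of the vectors of height one, hence is itself a relation of degree
-- one.
theorem overlap_pow_pow (h2 : (2 : F) ≠ 0) (i : ι) (s : ℕ) {w : List ι}
    (hw : s + 1 < w.length) :
    d.powTarget i * word F [i] ^ s - word F [i] ^ s * d.powTarget i ∈
      relSpan d.Rule {u | WordLT u w} := by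
  refine d.relLE_le_relSpan hw ?_
  rw [powTarget, lin_add_algebraMap_mul_sub]
  set y := d.lin (d.target i)
  have h1 : y * word F [i] - word F [i] * y ∈ d.relLE 2 := by
    have h := add_mem (d.comm_mem_of_even_left h2 (d.target_mem i) i)
      (d.relLE_mono one_le_two (d.lin_mem_of_mem_span (d.bracket_target_self i)))
    simpa using h
  clear hw
  induction s with
  | zero => simp
  | succ s ih =>
    have h3 := d.lin_mul_mem ih le_rfl (d.basis i)
    have h4 := d.word_mul_mem_relLE (A := []) (B := List.replicate s i) (n := s + 1 + 1) h1
      (by simp; omega)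
    rw [word_replicate] at h4
    simp only [lin_basis, word_nil, one_mul] at h3 h4
    convert add_mem h3 h4 using 1
    rw [pow_succ']
    noncomm_ring

omit [Fact p.Prime] [CharP F p] in
-- Both routes lead to `e_k e_j e_i` up to sign, and the remainders, brackets multiplied by a
-- letter, agree by the super Jacobi identity.
theorem overlap_swap_swap (h2 : (2 : F) ≠ 0) {i j k : ι} (hji : j < i) (hkj : k < j)
    (hi : 2 ≤ d.height i) (hj : 2 ≤ d.height j) (hk : 2 ≤ d.height k) :
    d.swapTarget i j * word F [k] - word F [i] * d.swapTarget j k ∈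
      relSpan d.Rule {u | WordLT u [i, j, k]} := by
  set I := relSpan d.Rule {u | WordLT u [i, j, k]} with hI
  set x := word F [i]
  set y := word F [j]
  set z := word F [k]
  have hki := hkj.trans hji
  -- `e1`, `e2` finish the route beginning with the swap of `i, j`, and `e3`, `e4` the one beginning
  -- with `j, k`. The later `f1`, `f2`, `f3` move each bracket past the third letter.
  have e1 : y * (x * z - d.swapTarget i k) ∈ I := by
    have := mem_relSpan (S := {u | WordLT u [i, j, k]}) (A := [j]) (B := [])
      (d.rule_swap hki hi hk) (wordLT_of_lt (u := [i, k]) (v := [j, k]) hji rfl [])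
    simpa [word_cons i [k]] using this
  have e2 : (y * z - d.swapTarget j k) * x ∈ I := by
    have := mem_relSpan (S := {u | WordLT u [i, j, k]}) (A := []) (B := [i])
      (d.rule_swap hkj hj hk) (wordLT_of_lt (u := [k, i]) (v := [j, k]) hji rfl [])
    simpa [word_cons j [k]] using this
  have e3 : (x * z - d.swapTarget i k) * y ∈ I := by
    have := mem_relSpan (S := {u | WordLT u [i, j, k]}) (A := []) (B := [j])
      (d.rule_swap hki hi hk) (wordLT_of_lt (u := [j]) (v := [k]) hkj rfl [i])
    simpa [word_cons i [k]] using this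
  have e4 : z * (x * y - d.swapTarget i j) ∈ I := by
    have := mem_relSpan (S := {u | WordLT u [i, j, k]}) (A := [k]) (B := [])
      (d.rule_swap hji hi hj) (wordLT_of_lt (u := [i, j]) (v := [j, k]) hki rfl [])
    simpa [word_cons i [j]] using this
  have hle : d.relLE 2 ≤ I := d.relLE_le_relSpan (by simp)
  have f1 := hle (d.comm_mem h2 (d.basis_mem i) (g.bracket_mem (d.basis_mem j) (d.basis_mem k)))
  have f2 := hle (d.comm_mem h2 (g.bracket_mem (d.basis_mem i) (d.basis_mem j)) (d.basis_mem k))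
  have f3 := hle (d.comm_mem h2 (d.basis_mem j) (g.bracket_mem (d.basis_mem i) (d.basis_mem k)))
  rw [koszulSign_add_right] at f1 f3
  rw [koszulSign_add_left] at f2
  rw [koszulSign_comm F (d.parity j) (d.parity i)] at f3
  change _ - (d.sgn i j * d.sgn i k) • _ - _ ∈ I at f1
  change _ - (d.sgn i k * d.sgn j k) • _ - _ ∈ I at f2
  change _ - (d.sgn i j * d.sgn j k) • _ - _ ∈ I at f3
  have hjac := congrArg d.lin
    (g.jacobi (d.basis_mem i) (d.basis_mem j) (d.basis k))
  rw [map_add, map_smul] at hjac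
  change _ = _ + d.sgn i j • _ at hjac
  rw [hjac] at f1
  simp only [swapTarget, word_cons _ [_], lin_basis] at e1 e2 e3 e4 f1 f2 f3 ⊢
  have key := add_mem (sub_mem (add_mem
      (sub_mem (add_mem (Submodule.smul_mem _ (d.sgn i j) e1)
        (Submodule.smul_mem _ (d.sgn i j * d.sgn i k) e2)) (Submodule.smul_mem _ (d.sgn j k) e3))
      (Submodule.smul_mem _ (-(d.sgn j k * d.sgn i k)) e4)) f1)
    (add_mem f2 (Submodule.smul_mem _ (d.sgn i j) f3))
  have hs : d.sgn i j * (d.sgn i j * d.sgn j k) = d.sgn j k := by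
    rw [← mul_assoc, d.sgn_mul_self, one_mul]
  convert key using 1
  simp only [mul_sub, sub_mul, mul_add, add_mul, smul_sub, smul_add, smul_smul, mul_smul_comm,
    smul_mul_assoc, hs, mul_assoc, neg_smul, neg_mul, x, y, z]
  rw [show d.sgn i j * (d.sgn i k * d.sgn j k) = d.sgn j k * (d.sgn i k * d.sgn i j) by ring,
    mul_comm (d.sgn i k) (d.sgn j k)]
  abel

theorem overlapsResolvable (h2 : (2 : F) ≠ 0) : OverlapsResolvable d.Rule := by
  rintro P S Q t t' hP hS hQ (⟨i, j, hji, hi, hj, h, rfl⟩ | ⟨i, h, rfl⟩)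
    (⟨k, l, hlk, hk, hl, h', rfl⟩ | ⟨k, h', rfl⟩)
  · obtain ⟨a, P, rfl⟩ := List.exists_cons_of_ne_nil hP
    obtain ⟨b, S, rfl⟩ := List.exists_cons_of_ne_nil hS
    obtain ⟨c, Q, rfl⟩ := List.exists_cons_of_ne_nil hQ
    have hl1 := congrArg List.length h
    have hl2 := congrArg List.length h'
    simp only [List.length_append, List.length_cons, List.length_nil] at hl1 hl2
    obtain rfl : P = [] := List.eq_nil_of_length_eq_zero (by omega)
    obtain rfl : S = [] := List.eq_nil_of_length_eq_zero (by omega)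
    obtain rfl : Q = [] := List.eq_nil_of_length_eq_zero (by omega)
    simp only [List.cons_append, List.nil_append, List.cons.injEq, and_true] at h h'
    obtain ⟨rfl, rfl⟩ := h
    obtain ⟨rfl, rfl⟩ := h'
    exact d.overlap_swap_swap h2 hji hlk hi hj hl
  · obtain ⟨a, P, rfl⟩ := List.exists_cons_of_ne_nil hP
    obtain ⟨b, S, rfl⟩ := List.exists_cons_of_ne_nil hS
    have hl1 := congrArg List.length h
    simp only [List.length_append, List.length_cons, List.length_nil] at hl1
    obtain rfl : P = [] := List.eq_nil_of_length_eq_zero (by omega)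
    obtain rfl : S = [] := List.eq_nil_of_length_eq_zero (by omega)
    simp only [List.cons_append, List.nil_append, List.cons.injEq, and_true] at h h'
    obtain ⟨rfl, rfl⟩ := h
    have h'' : [b] ++ Q = List.replicate (d.height k) k := h'
    obtain ⟨hl2, hb, hQ'⟩ := List.append_eq_replicate_iff.1 h''
    obtain rfl : b = k := by simpa using hb
    have hQl : Q.length = d.height b - 1 := by simp at hl2; omega
    have := d.overlap_swap_pow h2 hji hj hi rfl
    rw [← h'', ← List.append_assoc] at this
    convert this using 3
    rw [hQ', word_replicate, hQl]
  · obtain ⟨a, S, rfl⟩ := List.exists_cons_of_ne_nil hS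
    obtain ⟨b, Q, rfl⟩ := List.exists_cons_of_ne_nil hQ
    have hl1 := congrArg List.length h'
    simp only [List.length_append, List.length_cons, List.length_nil] at hl1
    obtain rfl : S = [] := List.eq_nil_of_length_eq_zero (by omega)
    obtain rfl : Q = [] := List.eq_nil_of_length_eq_zero (by omega)
    simp only [List.cons_append, List.nil_append, List.cons.injEq, and_true] at h'
    obtain ⟨rfl, rfl⟩ := h'
    obtain ⟨hl2, hP', hb⟩ := List.append_eq_replicate_iff.1 h
    obtain rfl : a = i := by simpa using hb
    have hPl : P.length = d.height a - 1 := by simp at hl2; omega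
    have := d.overlap_pow_swap h2 hlk hk hl rfl
    rw [← h] at this
    convert this using 3
    rw [hP', word_replicate, hPl]
  · obtain ⟨hl1, hP', hS1⟩ := List.append_eq_replicate_iff.1 h
    obtain ⟨hl2, hS2, hQ'⟩ := List.append_eq_replicate_iff.1 h'
    have hS0 := List.length_pos_iff.2 hS
    have hP0 := List.length_pos_iff.2 hP
    obtain rfl : i = k := by
      rw [hS1] at hS2
      simpa [hS0.ne'] using hS2
    have hPQ : P.length = Q.length := by omega
    have := d.overlap_pow_pow h2 i Q.length (w := P ++ S ++ Q) (by simp; omega)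
    convert this using 2
    · rw [hQ', word_replicate, List.length_replicate]
    · rw [hP', word_replicate, hPQ]

end Fintype

end LieSuperalgebra.HeightBasis

/-! ### The highest monomial and the functional reading off its coefficient -/

namespace LieSuperalgebra.HeightBasis

open FreeAlgebra LieSuperalgebra

variable {F V : Type*} [Field F] [AddCommGroup V] [Module F V] {g : LieSuperalgebra F V}
  {p : ℕ} {ι : Type*} (d : g.HeightBasis p ι)

section Top

variable [Fintype ι]

/-- The exponents of the highest monomial. -/
def topMultiset : Multiset ι := ∑ i, Multiset.replicate (d.height i - 1) i

theorem count_topMultiset [DecidableEq ι] (i : ι) :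
    d.topMultiset.count i = d.height i - 1 := by
  simp [topMultiset, Multiset.count_sum', Multiset.count_replicate]

theorem le_topMultiset [DecidableEq ι] {s : Multiset ι} :
    s ≤ d.topMultiset ↔ ∀ i, s.count i < d.height i := by
  rw [Multiset.le_iff_count]
  refine forall_congr' fun i => ?_
  have := d.height_pos i
  rw [d.count_topMultiset]
  omega

theorem sum_map_topMultiset {M : Type*} [AddCommMonoid M] (f : ι → M) :
    (d.topMultiset.map f).sum = ∑ i, (d.height i - 1) • f i := by
  rw [topMultiset, ← Multiset.coe_mapAddMonoidHom, map_sum, Multiset.sum_sum]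
  simp

variable [LinearOrder ι]

/-- The highest monomial. -/
def top : List ι := d.topMultiset.sort (· ≤ ·)

@[simp]
theorem coe_top : (d.top : Multiset ι) = d.topMultiset := Multiset.sort_eq _ _

theorem pairwise_top : d.top.Pairwise (· ≤ ·) := Multiset.pairwise_sort _ _

omit [Fintype ι] in
theorem exists_eq_append_replicate {u : List ι} (hu : u.Pairwise (· ≤ ·)) (i : ι) :
    ∃ A B, u = A ++ List.replicate (u.count i) i ++ B := by
  refine ⟨u.filter (· < i), u.filter (i < ·), ?_⟩
  refine List.Perm.eq_of_pairwise (le := (· ≤ ·)) (fun a b _ _ h h' => le_antisymm h h') hu ?_ ?_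
  · simp only [List.pairwise_append, List.mem_append, List.mem_filter, decide_eq_true_eq]
    refine ⟨⟨hu.filter _, List.pairwise_replicate.2 (Or.inr le_rfl), ?_⟩, hu.filter _, ?_⟩
    · rintro a ⟨-, ha⟩ b hb
      rw [List.eq_of_mem_replicate hb]
      exact ha.le
    · rintro a (⟨-, ha⟩ | ha) b ⟨-, hb⟩
      · exact (ha.trans hb).le
      · rw [List.eq_of_mem_replicate ha]
        exact hb.le
  · rw [List.perm_iff_count]
    intro a
    simp only [List.count_append, List.count_replicate]
    rcases lt_trichotomy a i with h | rfl | h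
    · rw [List.count_filter (by simpa using h), List.count_eq_zero_of_not_mem
        (l := u.filter (i < ·)) (by simp [h.le])]
      simp [h.ne']
    · rw [List.count_eq_zero_of_not_mem (l := u.filter (a < ·)) (by simp),
        List.count_eq_zero_of_not_mem (l := u.filter (· < a)) (by simp)]
      simp
    · rw [List.count_filter (l := u) (p := (i < ·)) (by simpa using h),
        List.count_eq_zero_of_not_mem (l := u.filter (· < i)) (by simp [h.le])]
      simp [h.ne]

theorem irredWord_top : IrredWord d.Rule d.top := by
  rintro A r t B (⟨i, j, hji, -, -, rfl, -⟩ | ⟨i, rfl, -⟩) h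
  · have := d.pairwise_top
    rw [h] at this
    have h2 := (List.pairwise_append.1 (List.pairwise_append.1 this).1).2.1
    simp only [List.pairwise_cons, List.mem_singleton, forall_eq] at h2
    exact absurd h2.1 (not_le.2 hji)
  · have h1 := d.le_topMultiset.1 le_rfl i
    rw [← coe_top, h, Multiset.coe_count] at h1
    simp only [List.count_append, List.count_replicate_self] at h1
    omega

omit [Fintype ι] in
-- An irreducible word has no letter of height one, so at any descent a swap would apply.
theorem pairwise_of_irredWord {u : List ι} (hu : IrredWord d.Rule u) : u.Pairwise (· ≤ ·) := by
  have hh : ∀ i ∈ u, 2 ≤ d.height i := by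
    intro i hi
    by_contra hlt
    have h1 : d.height i = 1 := by have := d.height_pos i; omega
    obtain ⟨A, B, rfl⟩ := List.append_of_mem hi
    exact hu A _ _ B (d.rule_pow i) (by simp [h1])
  rw [← List.isChain_iff_pairwise, List.isChain_iff_forall_rel_of_append_cons_cons]
  intro a b A B h
  by_contra hab
  exact hu A _ _ B (d.rule_swap (not_le.1 hab) (hh a (by simp [h])) (hh b (by simp [h])))
    (by simp [h])

theorem le_topMultiset_of_irredWord {u : List ι} (hu : IrredWord d.Rule u) :
    (u : Multiset ι) ≤ d.topMultiset := by
  rw [d.le_topMultiset]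
  intro i
  by_contra! hlt
  rw [Multiset.coe_count] at hlt
  obtain ⟨A, B, h⟩ := exists_eq_append_replicate (d.pairwise_of_irredWord hu) i
  refine hu A _ _ (List.replicate (u.count i - d.height i) i ++ B) (d.rule_pow i) ?_
  have e : List.replicate (u.count i) i =
      List.replicate (d.height i) i ++ List.replicate (u.count i - d.height i) i := by
    rw [← List.replicate_add, Nat.add_sub_cancel' hlt]
  conv_lhs => rw [h, e]
  simp only [List.append_assoc]

omit [Fintype ι] in
theorem eq_of_irredWord_of_perm {u v : List ι} (hu : IrredWord d.Rule u)
    (hv : IrredWord d.Rule v) (h : u.Perm v) : u = v :=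
  List.Perm.eq_of_pairwise (le := (· ≤ ·)) (fun _ _ _ _ h h' => le_antisymm h h')
    (d.pairwise_of_irredWord hu) (d.pairwise_of_irredWord hv) h

theorem length_top : d.top.length = d.topMultiset.card := by
  rw [← coe_top, Multiset.coe_card]

theorem length_le_of_irredWord {u : List ι} (hu : IrredWord d.Rule u) :
    u.length ≤ d.top.length := by
  rw [length_top, ← Multiset.coe_card]
  exact Multiset.card_le_card (d.le_topMultiset_of_irredWord hu)

theorem eq_top_of_length {u : List ι} (hu : IrredWord d.Rule u)
    (h : u.length = d.top.length) : u = d.top := by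
  refine d.eq_of_irredWord_of_perm hu d.irredWord_top (Multiset.coe_eq_coe.1 ?_)
  rw [coe_top]
  refine Multiset.eq_of_le_of_card_le (d.le_topMultiset_of_irredWord hu) ?_
  rw [← length_top, ← h, Multiset.coe_card]

/-- The rules never lengthen a word nor change its parity, so the whole reduction stays within these
bounds. -/
theorem word_mem_sup_irredWord (w : List ι) :
    word F w ∈ relSpan d.Rule Set.univ ⊔ Submodule.span F (word F '' {u | IrredWord d.Rule u ∧
      u ∈ {u | u.length ≤ w.length ∧ d.wordParity u = d.wordParity w}}) := by
  refine word_mem_relSpan_sup_span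
    (fun w => {u | u.length ≤ w.length ∧ d.wordParity u = d.wordParity w})
    (fun w => ⟨le_rfl, rfl⟩) (fun u v w h h' => ⟨h.1.trans h'.1, h.2.trans h'.2⟩) ?_ w
  intro A r t B hr
  refine span_mul_mem (fun u hu => ?_) (d.target_mem_span hr)
  refine Submodule.subset_span ⟨A ++ u ++ B, ⟨WordLT.context hu.1 A B, ?_, ?_⟩, by
    simp [word_append, mul_assoc]⟩
  · rcases List.shortlex_def.1 hu.1 with h | h <;> simp <;> omega
  · simp [hu.2]

/-- A functional compatible with the relations that singles out the highest monomial. -/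
structure IsTopFunctional (φ : FreeAlgebra F ι →ₗ[F] F) : Prop where
  relSpan_le : relSpan d.Rule Set.univ ≤ LinearMap.ker φ
  map_top : φ (word F d.top) = 1
  map_irredWord : ∀ u, IrredWord d.Rule u → u ≠ d.top → φ (word F u) = 0

theorem exists_isTopFunctional [Fact p.Prime] [CharP F p] (h2 : (2 : F) ≠ 0) :
    ∃ φ, d.IsTopFunctional φ := by
  classical
  obtain ⟨φ, h1, h3⟩ := exists_functional_of_irreducible d.decreasing d.inclusionFree
    (d.overlapsResolvable h2) fun u => if u = d.top then 1 else 0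
  exact ⟨φ, h1, by simp [h3 _ d.irredWord_top], fun u hu hne => by simp [h3 u hu, hne]⟩

end Top

namespace IsTopFunctional

variable {d} [Fintype ι] [LinearOrder ι] {φ : FreeAlgebra F ι →ₗ[F] F} (hφ : d.IsTopFunctional φ)

include hφ

theorem map_eq_zero_of_mem {z : FreeAlgebra F ι} (hz : z ∈ relSpan d.Rule Set.univ) : φ z = 0 :=
  hφ.relSpan_le hz

theorem map_context_relLE (A B : List ι) {n : ℕ} {z : FreeAlgebra F ι} (hz : z ∈ d.relLE n) :
    φ (word F A * z * word F B) = 0 :=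
  hφ.map_eq_zero_of_mem (relSpan_mono (Set.subset_univ _) (d.word_mul_mem_relLE hz le_rfl))

/-- Such a word reduces to irreducible words of no greater length and the same parity, none of which
is the highest monomial. -/
theorem map_word_of_ne {w : List ι}
    (h : w.length < d.top.length ∨ d.wordParity w ≠ d.wordParity d.top) :
    φ (word F w) = 0 := by
  obtain ⟨y, hy, z, hz, hyz⟩ := Submodule.mem_sup.1 (d.word_mem_sup_irredWord w)
  rw [← hyz, map_add, hφ.map_eq_zero_of_mem hy, zero_add]
  have hle : Submodule.span F (word F '' {u | IrredWord d.Rule u ∧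
      u ∈ {u | u.length ≤ w.length ∧ d.wordParity u = d.wordParity w}}) ≤ LinearMap.ker φ := by
    refine Submodule.span_le.2 ?_
    rintro _ ⟨u, ⟨hu, hl, hp⟩, rfl⟩
    refine hφ.map_irredWord u hu ?_
    rintro rfl
    rcases h with h | h
    · omega
    · exact h hp.symm
  exact hle hz

theorem map_span_eq_zero {A B : List ι} {n : ℕ} (h : A.length + n + B.length ≤ d.top.length)
    {z : FreeAlgebra F ι} (hz : z ∈ Submodule.span F (word F '' {u | u.length < n})) :
    φ (word F A * z * word F B) = 0 := by
  refine span_mul_mem (T := LinearMap.ker φ) (fun u hu => ?_) hz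
  rw [← word_append, ← word_append]
  refine hφ.map_word_of_ne (Or.inl ?_)
  have : u.length < n := hu
  simp
  omega

theorem map_lin_eq_zero {A B : List ι} (h : A.length + 2 + B.length ≤ d.top.length) (x : V) :
    φ (word F A * d.lin x * word F B) = 0 := by
  refine hφ.map_span_eq_zero h ?_
  rw [d.lin_eq_sum]
  exact sum_mem fun i _ => Submodule.smul_mem _ _ (Submodule.subset_span ⟨[i], by simp, rfl⟩)

/-- Exchanging neighbours costs a sign and a bracket term, and the latter is too short to be seen by
`φ`. -/
theorem map_perm (h2 : (2 : F) ≠ 0) {l l' : List ι} (h : l.Perm l') :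
    ∀ A B : List ι, A.length + l.length + B.length ≤ d.top.length →
      φ (word F (A ++ l ++ B)) = φ (word F (A ++ l' ++ B)) ∨
        φ (word F (A ++ l ++ B)) = -φ (word F (A ++ l' ++ B)) := by
  induction h with
  | nil => intro A B _; simp
  | @cons x l l' h ih =>
    intro A B hl
    simpa using ih (A ++ [x]) B (by simp at hl ⊢; omega)
  | swap i j l =>
    intro A B hl
    have h1 := hφ.map_context_relLE A (l ++ B) (d.comm_basis h2 j i)
    rw [mul_sub, sub_mul, map_sub, hφ.map_lin_eq_zero (by simp at hl ⊢; omega), sub_zero, mul_sub,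
      sub_mul, map_sub, sub_eq_zero, mul_smul_comm, smul_mul_assoc, map_smul] at h1
    simp only [← word_append] at h1
    rcases koszulSign_eq_one_or F (d.parity j) (d.parity i) with hs | hs
    · left; simpa [sgn, hs] using h1
    · right; simpa [sgn, hs] using h1
  | @trans l₁ l₂ l₃ h h' ih ih' =>
    intro A B hl
    have := ih A B hl
    rw [h.length_eq] at hl
    rcases this with h3 | h3 <;> rcases ih' A B hl with h4 | h4 <;> rw [h3, h4] <;> simp

theorem map_ne_zero_of_perm (h2 : (2 : F) ≠ 0) {w : List ι} (h : (w : Multiset ι) = d.topMultiset) :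
    φ (word F w) ≠ 0 := by
  rw [← coe_top, Multiset.coe_eq_coe] at h
  have := hφ.map_perm h2 h [] [] (by simp [h.length_eq])
  simp only [List.nil_append, List.append_nil, hφ.map_top] at this
  rcases this with h | h <;> simp [h]

/-- A word of full length with the wrong letters contains some letter at least as often as its
height. Collecting these copies changes `φ` only by a sign, and the power rule then shortens the
word or kills it. -/
theorem map_eq_zero_of_not_perm (h2 : (2 : F) ≠ 0) {w : List ι} (hl : w.length ≤ d.top.length)
    (h : (w : Multiset ι) ≠ d.topMultiset) : φ (word F w) = 0 := by
  rcases hl.lt_or_eq with hl | hl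
  · exact hφ.map_word_of_ne (Or.inl hl)
  have hnle : ¬ (w : Multiset ι) ≤ d.topMultiset := fun hle =>
    h (Multiset.eq_of_le_of_card_le hle (by rw [← length_top, ← hl, Multiset.coe_card]))
  rw [d.le_topMultiset] at hnle
  push Not at hnle
  obtain ⟨i, hi⟩ := hnle
  rw [Multiset.coe_count, ← List.replicate_sublist_iff] at hi
  obtain ⟨u, hu⟩ := hi.exists_perm_append
  have hlu := hu.length_eq
  simp only [List.length_append, List.length_replicate] at hlu
  have h0 : φ (word F (List.replicate (d.height i) i ++ u)) = 0 := by
    have h1 := hφ.map_context_relLE [] u (d.word_sub_powTarget_mem i)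
    have h3 : φ (word F [] * d.powTarget i * word F u) = 0 := by
      refine hφ.map_span_eq_zero (n := d.height i) (by simp; omega) ?_
      by_cases h1 : d.height i = 1
      · simp [powTarget, d.target_of_height_one i h1, d.const_of_height_one i h1]
      have hi2 : 2 ≤ d.height i := by have := d.height_pos i; omega
      refine add_mem ?_ ?_
      · rw [d.lin_eq_sum]
        exact sum_mem fun j _ => Submodule.smul_mem _ _ (Submodule.subset_span
          ⟨[j], by simp; omega, rfl⟩)
      · rw [Algebra.algebraMap_eq_smul_one]
        exact Submodule.smul_mem _ _ (Submodule.subset_span ⟨[], by simp; omega, rfl⟩)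
    rw [mul_sub, sub_mul, map_sub, h3, sub_zero] at h1
    simpa [word_append] using h1
  have := hφ.map_perm h2 hu [] [] (by simp [hl])
  simpa [h0] using this

/-- The trace of an even element occurs as its commutator with the highest monomial. -/
theorem map_commutator (h2 : (2 : F) ≠ 0) {x : V} (hx : x ∈ g.part 0) (l : List ι) :
    ∀ A : List ι, ((A ++ l : List ι) : Multiset ι) = d.topMultiset →
      φ (word F A * (d.lin x * word F l - word F l * d.lin x)) =
        (l.map fun i => d.basis.repr (g.bracket x (d.basis i)) i).sum * φ (word F (A ++ l)) := by
  induction l with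
  | nil => intro A _; simp
  | cons i l ih =>
    intro A hA
    have h1 := hφ.map_context_relLE A l (d.comm_mem_of_even_left h2 hx i)
    have h3 := ih (A ++ [i]) (by simpa using hA)
    -- Replacing the letter `e_i` by a different basis vector spoils the multiset of letters, so
    -- only the diagonal coefficient of `ad x` survives.
    have h4 : φ (word F A * d.lin (g.bracket x (d.basis i)) * word F l) =
        d.basis.repr (g.bracket x (d.basis i)) i * φ (word F (A ++ i :: l)) := by
      rw [d.lin_eq_sum, Finset.mul_sum, Finset.sum_mul, map_sum, Finset.sum_eq_single i]
      · rw [mul_smul_comm, smul_mul_assoc, map_smul, smul_eq_mul, ← word_append, ← word_append]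
        simp
      · intro j _ hj
        rw [mul_smul_comm, smul_mul_assoc, map_smul, ← word_append, ← word_append,
          hφ.map_eq_zero_of_not_perm h2, smul_zero]
        · rw [length_top, ← hA, Multiset.coe_card]
          simp
        · rw [← hA, Ne, Multiset.coe_eq_coe]
          intro h
          have := h.count_eq i
          simp [hj] at this
      · simp
    have e : word F A * (d.lin x * word F (i :: l) - word F (i :: l) * d.lin x) =
        word F A * (d.lin x * word F [i] - word F [i] * d.lin x -
          d.lin (g.bracket x (d.basis i))) * word F l +
        word F A * d.lin (g.bracket x (d.basis i)) * word F l +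
        word F (A ++ [i]) * (d.lin x * word F l - word F l * d.lin x) := by
      rw [word_append, word_cons i l]
      noncomm_ring
    rw [e, map_add, map_add, h1, h3, h4, List.map_cons, List.sum_cons]
    simp
    ring

theorem map_commutator_top (h2 : (2 : F) ≠ 0) {x : V} (hx : x ∈ g.part 0) :
    φ (d.lin x * word F d.top - word F d.top * d.lin x) =
      ∑ i, (d.height i - 1) • d.basis.repr (g.bracket x (d.basis i)) i := by
  have := hφ.map_commutator h2 hx d.top [] (by simp)
  rw [← d.sum_map_topMultiset, ← coe_top, Multiset.map_coe, Multiset.sum_coe]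
  simpa [hφ.map_top] using this

end IsTopFunctional

end LieSuperalgebra.HeightBasis

/-! ### Existence of a basis adapted to the rewriting system -/

theorem Submodule.exists_basis_extending {F W : Type*} [Field F] [AddCommGroup W] [Module F W]
    [FiniteDimensional F W] (K : Submodule F W) :
    ∃ (κ : Type) (_ : Fintype κ) (b : Module.Basis κ F W) (S : Set κ),
      Submodule.span F (b '' S) = K := by
  obtain ⟨C, hC⟩ := K.exists_isCompl
  refine ⟨Fin (Module.finrank F K) ⊕ Fin (Module.finrank F C), inferInstance,
    ((Module.finBasis F K).prod (Module.finBasis F C)).map (K.prodEquivOfIsCompl C hC),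
    Set.range Sum.inl, ?_⟩
  rw [← Set.range_comp]
  have : (⇑(((Module.finBasis F K).prod (Module.finBasis F C)).map
      (K.prodEquivOfIsCompl C hC)) ∘ Sum.inl) = K.subtype ∘ Module.finBasis F K := by
    ext i
    simp
  rw [this, Set.range_comp, ← Submodule.map_span, (Module.finBasis F K).span_eq,
    Submodule.map_top, Submodule.range_subtype]

namespace LieSuperalgebra

variable {F V : Type*} [Field F] [AddCommGroup V] [Module F V] (g : LieSuperalgebra F V)

theorem proj_of_mem {i : ZMod 2} {x : V} (hx : x ∈ g.part i) : g.proj i x = ⟨x, hx⟩ := by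
  ext
  exact DirectSum.decompose_of_mem_same g.part hx

theorem proj_of_mem_ne {i j : ZMod 2} (hij : i ≠ j) {x : V} (hx : x ∈ g.part i) :
    g.proj j x = 0 := by
  ext
  exact DirectSum.decompose_of_mem_ne g.part hx hij

theorem collectedBasis_repr {α : ZMod 2 → Type*} (v : ∀ i, Module.Basis (α i) F (g.part i))
    (x : V) (i : ZMod 2) (a : α i) :
    (g.isInternal.collectedBasis v).repr x ⟨i, a⟩ = (v i).repr (g.proj i x) a := by
  induction x using DirectSum.Decomposition.inductionOn g.part with
  | zero => simp
  | @homogeneous j x =>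
    by_cases h : j = i
    · subst h
      rw [g.isInternal.collectedBasis_repr_of_mem v x.2, g.proj_of_mem x.2]
    · rw [g.isInternal.collectedBasis_repr_of_mem_ne v h x.2, g.proj_of_mem_ne h x.2]
      simp
  | add x y hx hy => simp [hx, hy]

theorem two_smul_bracket_bracket {x : V} (hx : x ∈ g.part 1) (z : V) :
    (2 : F) • g.bracket x (g.bracket x z) = g.bracket (g.bracket x x) z := by
  have := g.jacobi hx hx z
  rw [koszulSign_one_one, neg_one_smul, ← sub_eq_add_neg, eq_sub_iff_add_eq] at this
  rw [two_smul, this]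

theorem bracket_self_mem {x : V} (hx : x ∈ g.part 1) : g.bracket x x ∈ g.part 0 := by
  have h := g.bracket_mem hx hx
  rwa [show (1 + 1 : ZMod 2) = 0 by decide] at h

theorem cube_mem {x : V} (hx : x ∈ g.part 1) : g.bracket x (g.bracket x x) ∈ g.part 1 := by
  simpa using g.bracket_mem hx (g.bracket_self_mem hx)

/-- The cube of an odd element is central (it vanishes unless the characteristic is three). -/
theorem bracket_cube {x : V} (hx : x ∈ g.part 1) (z : V) :
    g.bracket (g.bracket x (g.bracket x x)) z = 0 := by
  -- Since `ad [x, x] = 2 (ad x) ^ 2`, both `[x, [[x, x], z]]` and `[[x, x], [x, z]]` equal `2 (ad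
  -- x) ^ 3 z`, which leaves nothing for the cube.
  have h := g.jacobi hx (g.bracket_self_mem hx) z
  rw [koszulSign_zero_right, one_smul, ← g.two_smul_bracket_bracket hx,
    ← g.two_smul_bracket_bracket hx (g.bracket x z), map_smul, right_eq_add] at h
  exact h

/-- The span of the cubes of the odd elements. -/
def cubeSpan : Submodule F V := Submodule.span F {y | ∃ x ∈ g.part 1, y = g.bracket x (g.bracket x x)}

theorem cubeSpan_le : g.cubeSpan ≤ g.part 1 :=
  Submodule.span_le.2 fun _ ⟨_, hx, hy⟩ => hy ▸ g.cube_mem hx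

theorem bracket_of_mem_cubeSpan {y : V} (hy : y ∈ g.cubeSpan) (z : V) : g.bracket y z = 0 := by
  have : g.cubeSpan ≤ LinearMap.ker (g.bracket.flip z) :=
    Submodule.span_le.2 fun _ ⟨x, hx, hy⟩ => by
      rw [hy]
      exact g.bracket_cube hx z
  exact this hy

/-- A homogeneous basis, part of which spans the cubes of the odd elements. -/
theorem exists_homogeneous_basis [FiniteDimensional F V] :
    ∃ (κ : Type) (_ : Fintype κ) (b : Module.Basis κ F V) (par : κ → ZMod 2) (S : Set κ),
      (∀ k, b k ∈ g.part (par k)) ∧ (∀ k ∈ S, par k = 1) ∧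
      Submodule.span F (b '' S) = g.cubeSpan ∧
      ∀ A : V →ₗ[F] V, g.supertrace A =
        ∑ k, koszulSign F (par k) (par k) * b.repr (A (b k)) k := by
  choose α hα v S hS using fun i : ZMod 2 =>
    Submodule.exists_basis_extending (g.cubeSpan.comap (g.part i).subtype)
  refine ⟨Σ i, α i, inferInstance, g.isInternal.collectedBasis v, Sigma.fst,
    {k | k.1 = 1 ∧ k.2 ∈ S k.1}, fun k => g.isInternal.collectedBasis_mem v k, fun k hk => hk.1,
    ?_, fun A => ?_⟩
  · have h1 : (g.isInternal.collectedBasis v) '' {k | k.1 = 1 ∧ k.2 ∈ S k.1} =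
        (g.part 1).subtype '' (v 1 '' S 1) := by
      ext x
      constructor
      · rintro ⟨⟨i, k⟩, ⟨hi, hk⟩, rfl⟩
        obtain rfl : i = 1 := hi
        exact ⟨v 1 k, ⟨k, hk, rfl⟩, by simp⟩
      · rintro ⟨_, ⟨k, hk, rfl⟩, rfl⟩
        exact ⟨⟨1, k⟩, ⟨rfl, hk⟩, by simp⟩
    rw [h1, ← Submodule.map_span, hS, Submodule.map_comap_subtype, inf_eq_right]
    exact g.cubeSpan_le
  · classical
    have h (i : ZMod 2) : LinearMap.trace F (g.part i) (g.proj i ∘ₗ A ∘ₗ (g.part i).subtype) =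
        ∑ k : α i, (g.isInternal.collectedBasis v).repr
          (A (g.isInternal.collectedBasis v ⟨i, k⟩)) ⟨i, k⟩ := by
      rw [LinearMap.trace_eq_matrix_trace F (v i), Matrix.trace]
      refine Finset.sum_congr rfl fun k _ => ?_
      rw [g.collectedBasis_repr]
      simp [LinearMap.toMatrix_apply]
    rw [Fintype.sum_sigma]
    have h2 (f : ZMod 2 → F) : ∑ i, f i = f 0 + f 1 := Fin.sum_univ_two f
    rw [h2, supertrace, h, h]
    simp [Finset.sum_neg_distrib, sub_eq_add_neg]

end LieSuperalgebra

namespace RestrictedLieSuperalgebra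

open LieSuperalgebra

variable {F V : Type*} [Field F] [AddCommGroup V] [Module F V] {p : ℕ}

/-- The reduced enveloping algebra has an adapted basis. -/
theorem exists_heightBasis [FiniteDimensional F V] (g : RestrictedLieSuperalgebra F V p)
    (χ : Module.Dual F (g.part 0)) (hp : 2 < p) (h2 : (2 : F) ≠ 0) :
    ∃ (κ : Type) (_ : Fintype κ) (_ : LinearOrder κ) (d : g.HeightBasis p κ),
      (∀ k (h : d.basis k ∈ g.part 0), d.parity k = 0 →
        d.target k = g.pmap ⟨d.basis k, h⟩ ∧ d.const k = χ ⟨d.basis k, h⟩ ^ p) ∧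
      (∀ k, d.height k = 1 → d.basis k ∈ g.cubeSpan) ∧
      ∀ A : V →ₗ[F] V, g.supertrace A =
        ∑ k, koszulSign F (d.parity k) (d.parity k) * d.basis.repr (A (d.basis k)) k := by
  classical
  obtain ⟨κ, hκ, b, par, S, hb, hS, hspan, htr⟩ := g.exists_homogeneous_basis
  have hb0 : ∀ k, par k = 0 → b k ∈ g.part 0 := fun k h => h ▸ hb k
  have hb1 : ∀ k, par k ≠ 0 → b k ∈ g.part 1 := fun k h =>
    (zmod_two_eq_zero_or_one (par k)).resolve_left h ▸ hb k
  have hS0 : ∀ k ∈ S, par k ≠ 0 := fun k hk => by rw [hS k hk]; decide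
  -- Basis vectors of the cube span vanish in `U(g)` and get height one. Other odd vectors satisfy
  -- `e ^ 2 = [e, e] / 2` and get height two.
  let ht : κ → ℕ := fun k => if par k = 0 then p else if k ∈ S then 1 else 2
  have hht : {k | ht k = 1} = S := by
    ext k
    by_cases h0 : par k = 0
    · have : k ∉ S := fun hk => hS0 k hk h0
      simp [ht, h0, this]
      omega
    · by_cases hk : k ∈ S <;> simp [ht, h0, hk]
  have hcube : ∀ k, ht k = 1 → b k ∈ g.cubeSpan := fun k hk => by
    rw [← hspan]
    exact Submodule.subset_span ⟨k, hht ▸ hk, rfl⟩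
  have hne : ∀ k, par k = 0 → ht k ≠ 1 := fun k h => by simp [ht, h]; omega
  refine ⟨κ, hκ, LinearOrder.lift' (Fintype.equivFin κ) (Fintype.equivFin κ).injective,
    { basis := b
      parity := par
      basis_mem := hb
      height := ht
      height_pos := ?_
      height_even := ?_
      height_odd := ?_
      target := fun k => if h : par k = 0 then g.pmap ⟨b k, hb0 k h⟩ else
        if k ∈ S then 0 else (2 : F)⁻¹ • g.bracket (b k) (b k)
      const := fun k => if h : par k = 0 then χ ⟨b k, hb0 k h⟩ ^ p else 0
      target_mem := ?_
      bracket_target := ?_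
      bracket_target_self := ?_
      height_two := ?_
      bracket_of_height_one := fun k hk => g.bracket_of_mem_cubeSpan (hcube k hk)
      target_of_height_one := ?_
      const_of_height_one := ?_ }, ?_, hcube, htr⟩
  · intro k
    simp only [ht]
    split_ifs <;> omega
  · intro k hk
    simp [ht, hk]
  · intro k hk
    simp only [ht, hk]
    split_ifs with h
    · exact absurd h (by decide)
    · omega
    · omega
  · intro k
    split_ifs with h h'
    · exact (g.pmap _).2
    · exact zero_mem _
    · exact Submodule.smul_mem _ _ (g.bracket_self_mem (hb1 k h))
  · intro k hk z
    by_cases h : par k = 0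
    · simp only [ht, h, dif_pos, if_pos]
      rw [g.bracket_pmap, Module.End.pow_apply]
    · have hkS : k ∉ S := fun hS => by simp [ht, h, hS] at hk
      simp only [ht, h, hkS, dif_neg, if_neg, not_false_eq_true]
      rw [map_smul, LinearMap.smul_apply, ← g.two_smul_bracket_bracket (hb1 k h), smul_smul,
        inv_mul_cancel₀ h2, one_smul]
      rfl
  · intro k
    rw [hht, hspan]
    split_ifs with h h'
    · rw [g.bracket_pmap, Module.End.pow_apply]
      have h0 : g.bracket (b k) (b k) = 0 := by
        have := g.skew (hb0 k h) (hb0 k h)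
        rw [koszulSign_zero_left, one_smul, eq_neg_iff_add_eq_zero, ← two_smul F,
          smul_eq_zero] at this
        exact this.resolve_left h2
      obtain ⟨n, rfl⟩ : ∃ n, p = n + 1 := ⟨p - 1, by omega⟩
      rw [Function.iterate_succ_apply, h0, ← Module.End.pow_apply, map_zero]
      exact zero_mem _
    · simp
    -- By skew symmetry this bracket is a multiple of the cube of the odd basis vector.
    · rw [map_smul, LinearMap.smul_apply, g.skew (g.bracket_self_mem (hb1 k h)) (hb1 k h)]
      exact Submodule.smul_mem _ _ (neg_mem (Submodule.smul_mem _ _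
        (Submodule.subset_span ⟨b k, hb1 k h, rfl⟩)))
  · intro k hk hk2
    have h : par k ≠ 0 := by rw [hk]; decide
    have hkS : k ∉ S := fun hS => by simp [ht, h, hS] at hk2
    simp [h, hkS, smul_smul, h2]
  · intro k hk
    have hkS : k ∈ S := hht ▸ hk
    simp [hS0 k hkS, hkS]
  · intro k hk
    have hkS : k ∈ S := hht ▸ hk
    simp [hS0 k hkS]
  · intro k h hk
    change par k = 0 at hk
    simp [hk]

end RestrictedLieSuperalgebra

/-! ### The reduced enveloping algebra as the quotient by the rules -/

namespace FreeAlgebra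

variable {F ι : Type*} [Field F] {Rule : List ι → FreeAlgebra F ι → Prop}

theorem mul_mem_relSpan_univ {z : FreeAlgebra F ι} (hz : z ∈ relSpan Rule Set.univ)
    (a : FreeAlgebra F ι) : a * z ∈ relSpan Rule Set.univ := by
  have ha : a ∈ Submodule.span F (Set.range (word F (ι := ι))) := by
    rw [span_range_word]; trivial
  induction ha using Submodule.span_induction with
  | mem x hx =>
    obtain ⟨A, rfl⟩ := hx
    simpa using word_mul_mem_relSpan (A := A) (B := []) (S' := Set.univ)
      (fun _ _ => Set.mem_univ _) hz
  | zero => simp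
  | add x y _ _ hx hy => simpa [add_mul] using add_mem hx hy
  | smul c x _ hx => simpa using Submodule.smul_mem _ c hx

theorem mem_relSpan_univ_mul {z : FreeAlgebra F ι} (hz : z ∈ relSpan Rule Set.univ)
    (a : FreeAlgebra F ι) : z * a ∈ relSpan Rule Set.univ := by
  have ha : a ∈ Submodule.span F (Set.range (word F (ι := ι))) := by
    rw [span_range_word]; trivial
  induction ha using Submodule.span_induction with
  | mem x hx =>
    obtain ⟨A, rfl⟩ := hx
    simpa using word_mul_mem_relSpan (A := []) (B := A) (S' := Set.univ)
      (fun _ _ => Set.mem_univ _) hz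
  | zero => simp
  | add x y _ _ hx hy => simpa [mul_add] using add_mem hx hy
  | smul c x _ hx => simpa using Submodule.smul_mem _ c hx

/-- The two-sided ideal generated by the rewriting rules. -/
def relIdeal (Rule : List ι → FreeAlgebra F ι → Prop) : Ideal (FreeAlgebra F ι) where
  carrier := relSpan Rule Set.univ
  add_mem' := add_mem
  zero_mem' := zero_mem _
  smul_mem' a _ hz := mul_mem_relSpan_univ hz a

instance (Rule : List ι → FreeAlgebra F ι → Prop) : (relIdeal Rule).IsTwoSided :=
  ⟨fun a hz => mem_relSpan_univ_mul hz a⟩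

end FreeAlgebra

namespace RestrictedLieSuperalgebra

open LieSuperalgebra FreeAlgebra LieSuperalgebra.HeightBasis

variable {F V : Type*} [Field F] [AddCommGroup V] [Module F V] {p : ℕ}
  (g : RestrictedLieSuperalgebra F V p) (χ : Module.Dual F (g.part 0))

theorem pmap_zero (hp : 0 < p) : g.pmap 0 = 0 := by
  simpa [hp.ne'] using g.pmap_smul 0 0

/-- The relations `x ^ p = x^[p] + χ(x) ^ p` hold as soon as they hold on a spanning set. -/
theorem pow_eq_of_span [Fact p.Prime] [CharP F p] {S : Type*} [Ring S] [Algebra F S]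
    (ψ : V →ₗ[F] S)
    (hψ : ∀ x ∈ g.part 0, ∀ y ∈ g.part 0, ψ (g.bracket x y) = ψ x * ψ y - ψ y * ψ x)
    {B : Set V} (hB : Submodule.span F B ≤ g.part 0)
    (h : ∀ x ∈ B, ∀ hx : x ∈ g.part 0,
      ψ x ^ p = ψ (g.pmap ⟨x, hx⟩) + algebraMap F S (χ ⟨x, hx⟩ ^ p))
    {x : V} (hxB : x ∈ Submodule.span F B) (hx : x ∈ g.part 0) :
    ψ x ^ p = ψ (g.pmap ⟨x, hx⟩) + algebraMap F S (χ ⟨x, hx⟩ ^ p) := by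
  have hp : p.Prime := Fact.out
  induction hxB using Submodule.span_induction with
  | mem x hxB => exact h x hxB hx
  | zero =>
    have : (⟨0, hx⟩ : g.part 0) = 0 := rfl
    rw [this, g.pmap_zero hp.pos]
    simp [hp.ne_zero]
  | add x y hxB hyB ihx ihy =>
    have hx' := hB hxB
    have hy' := hB hyB
    have e : (⟨x + y, hx⟩ : g.part 0) = ⟨x, hx'⟩ + ⟨y, hy'⟩ := rfl
    -- The Jacobson terms of the `p`-th power of a sum are those in `pmap_add`, and `χ ^ p` is
    -- additive by Frobenius.
    rw [map_add, g.add_pow_eq_add_jacobsonS ψ hψ hx' hy', e, g.pmap_add, ihx hx', ihy hy',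
      map_add χ, add_pow_char, map_add, map_add, map_add]
    abel
  | smul c x hxB ihx =>
    have hx' := hB hxB
    have e : (⟨c • x, hx⟩ : g.part 0) = c • ⟨x, hx'⟩ := rfl
    rw [map_smul, e, g.pmap_smul, smul_pow, ihx hx', smul_add, map_smul, smul_eq_mul, mul_pow,
      map_mul, Submodule.coe_smul, map_smul, Algebra.smul_def (c ^ p) (algebraMap F S _)]

/-- The universal property of the reduced enveloping algebra. -/
theorem exists_algHom {S : Type*} [Ring S] [Algebra F S] (ψ : V →ₗ[F] S)
    (hcomm : ∀ (i j : ZMod 2) (x y : V), x ∈ g.part i → y ∈ g.part j →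
      ψ x * ψ y = koszulSign F i j • (ψ y * ψ x) + ψ (g.bracket x y))
    (hpow : ∀ x : g.part 0, ψ x ^ p = ψ (g.pmap x) + algebraMap F S (χ x ^ p)) :
    ∃ f : g.ReducedEnveloping χ →ₐ[F] S, ∀ x, f (g.redι χ x) = ψ x := by
  let e : g.Enveloping →ₐ[F] S := RingQuot.liftAlgHom F ⟨TensorAlgebra.lift F ψ, by
    rintro _ _ ⟨hx, hy⟩
    simpa using hcomm _ _ _ _ hx hy⟩
  have he : ∀ x, e (g.envι x) = ψ x := fun x => by
    have h : e (g.envMk (TensorAlgebra.ι F x)) = TensorAlgebra.lift F ψ (TensorAlgebra.ι F x) :=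
      RingQuot.liftAlgHom_mkAlgHom_apply F _ _ _
    rwa [TensorAlgebra.lift_ι_apply] at h
  let f : g.ReducedEnveloping χ →ₐ[F] S := RingQuot.liftAlgHom F ⟨e, by
    rintro _ _ ⟨x⟩
    rw [map_pow, map_add, AlgHom.commutes, he, he]
    exact hpow x⟩
  refine ⟨f, fun x => ?_⟩
  have h : f (g.redMk χ (g.envι x)) = e (g.envι x) := RingQuot.liftAlgHom_mkAlgHom_apply F _ _ _
  rwa [he] at h

/-- In the enveloping algebra `[x, x]` becomes `2 x ^ 2`, which commutes with `x`. -/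
theorem redι_of_mem_cubeSpan {y : V} (hy : y ∈ g.cubeSpan) :
    g.redι χ y = 0 := by
  have : g.cubeSpan ≤ LinearMap.ker (g.redι χ) := Submodule.span_le.2 fun _ ⟨x, hx, hy⟩ => by
    have h1 := g.redι_comm χ hx hx
    rw [koszulSign_one_one, neg_one_smul, eq_neg_add_iff_add_eq, ← two_smul F] at h1
    have h3 := g.redι_comm χ hx (g.bracket_self_mem hx)
    rw [koszulSign_zero_right, one_smul, ← h1, mul_smul_comm, smul_mul_assoc, mul_assoc,
      left_eq_add] at h3
    rw [hy]
    exact h3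
  exact this hy

variable {κ : Type*} (d : g.HeightBasis p κ)

/-- The projection from the free algebra on a basis to the reduced enveloping algebra. -/
noncomputable def freeToRed : FreeAlgebra F κ →ₐ[F] g.ReducedEnveloping χ :=
  FreeAlgebra.lift F fun k => g.redι χ (d.basis k)

theorem freeToRed_lin (x : V) : g.freeToRed χ d (d.lin x) = g.redι χ x := by
  have : (g.freeToRed χ d).toLinearMap ∘ₗ d.lin = g.redι χ :=
    d.basis.ext fun k => by simp [freeToRed, word_singleton]
  exact LinearMap.congr_fun this x

theorem freeToRed_surjective : Function.Surjective (g.freeToRed χ d) := by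
  have h : (g.freeToRed χ d).comp (TensorAlgebra.lift F d.lin) = (g.redMk χ).comp g.envMk := by
    apply TensorAlgebra.hom_ext
    ext x
    simpa [redι, envι] using g.freeToRed_lin χ d x
  have hs : Function.Surjective ((g.redMk χ).comp g.envMk) := by
    rw [AlgHom.coe_comp]
    exact (RingQuot.mkAlgHom_surjective F _).comp (RingQuot.mkAlgHom_surjective F _)
  rw [← h, AlgHom.coe_comp] at hs
  exact hs.of_comp

variable [LinearOrder κ]
  (hd : ∀ k (h : d.basis k ∈ g.part 0), d.parity k = 0 →
    d.target k = g.pmap ⟨d.basis k, h⟩ ∧ d.const k = χ ⟨d.basis k, h⟩ ^ p)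
  (hcube : ∀ k, d.height k = 1 → d.basis k ∈ g.cubeSpan)

include hd hcube

theorem freeToRed_eq_zero (h2 : (2 : F) ≠ 0) {z : FreeAlgebra F κ}
    (hz : z ∈ relSpan d.Rule Set.univ) : g.freeToRed χ d z = 0 := by
  have hle : relSpan d.Rule Set.univ ≤ LinearMap.ker (g.freeToRed χ d).toLinearMap := by
    refine Submodule.span_le.2 ?_
    rintro _ ⟨A, r, t, B, hr, -, rfl⟩
    suffices h : g.freeToRed χ d (word F r) = g.freeToRed χ d t by
      simp [h]
    rcases hr with ⟨i, j, -, -, -, rfl, rfl⟩ | ⟨i, rfl, rfl⟩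
    · have := g.redι_comm χ (d.basis_mem i) (d.basis_mem j)
      simp only [← g.freeToRed_lin χ d, d.lin_basis] at this
      rw [swapTarget, word_cons i [j], word_cons j [i], map_add, map_mul, map_smul, map_mul]
      exact this
    · rw [word_replicate, map_pow, ← d.lin_basis, freeToRed_lin, powTarget, map_add,
        freeToRed_lin, AlgHom.commutes]
      rcases zmod_two_eq_zero_or_one (d.parity i) with h0 | h0
      · have hm : d.basis i ∈ g.part 0 := h0 ▸ d.basis_mem i
        obtain ⟨h1, h3⟩ := hd i hm h0
        rw [d.height_even i h0, h1, h3]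
        exact g.redι_pow χ ⟨_, hm⟩
      · have hm : d.basis i ∈ g.part 1 := h0 ▸ d.basis_mem i
        by_cases h1 : d.height i = 1
        · rw [d.target_of_height_one i h1, d.const_of_height_one i h1, h1,
            g.redι_of_mem_cubeSpan χ (hcube i h1)]
          simp
        · have hh : d.height i = 2 := by
            have := d.height_pos i
            have := d.height_odd i h0
            omega
          obtain ⟨h3, h4⟩ := d.height_two i h0 hh
          have h5 := g.redι_comm χ hm hm
          rw [koszulSign_one_one, neg_one_smul, eq_neg_add_iff_add_eq, ← two_smul F, ← h3,
            map_smul] at h5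
          rw [h4, map_zero, add_zero, hh, pow_two]
          exact smul_right_injective _ h2 h5
  exact hle hz

variable [Fintype κ] [Fact p.Prime] [CharP F p]

omit hcube in
/-- The rewriting rules generate all relations of the reduced enveloping algebra. -/
theorem mem_relSpan_of_freeToRed_eq_zero (h2 : (2 : F) ≠ 0) {z : FreeAlgebra F κ}
    (hz : g.freeToRed χ d z = 0) : z ∈ relSpan d.Rule Set.univ := by
  let J := relIdeal d.Rule
  let q : FreeAlgebra F κ →ₐ[F] FreeAlgebra F κ ⧸ J := Ideal.Quotient.mkₐ F J
  have hq : ∀ y ∈ relSpan d.Rule Set.univ, q y = 0 := fun y hy =>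
    Ideal.Quotient.eq_zero_iff_mem.2 hy
  have hJ : ∀ n, d.relLE n ≤ relSpan d.Rule Set.univ := fun n => relSpan_mono (Set.subset_univ _)
  let ψ : V →ₗ[F] FreeAlgebra F κ ⧸ J := q.toLinearMap ∘ₗ d.lin
  have hcomm : ∀ (i j : ZMod 2) (x y : V), x ∈ g.part i → y ∈ g.part j →
      ψ x * ψ y = koszulSign F i j • (ψ y * ψ x) + ψ (g.bracket x y) := by
    intro i j x y hx hy
    have := hq _ (hJ 2 (d.comm_mem h2 hx hy))
    rw [sub_sub, map_sub, sub_eq_zero] at this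
    simpa [ψ] using this
  have hpow : ∀ x : g.part 0, ψ x ^ p = ψ (g.pmap x) + algebraMap F _ (χ x ^ p) := by
    intro x
    have hspan : Submodule.span F (d.basis '' {k | d.parity k = 0}) ≤ g.part 0 := by
      refine Submodule.span_le.2 ?_
      rintro _ ⟨k, hk, rfl⟩
      exact hk ▸ d.basis_mem k
    -- The rules give the power relation only on basis vectors. Jacobson's formula carries it to all
    -- even elements.
    refine g.pow_eq_of_span χ ψ (fun x hx y hy => ?_) hspan ?_ (d.part_le_span 0 x.2) x.2
    · have := hcomm 0 0 x y hx hy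
      rw [koszulSign_zero_left, one_smul] at this
      rw [this, add_sub_cancel_left]
    · rintro _ ⟨k, hk, rfl⟩ hx
      have := hq _ (hJ _ (d.word_sub_powTarget_mem k))
      obtain ⟨h1, h3⟩ := hd k hx hk
      rw [map_sub, sub_eq_zero, powTarget, map_add, word_replicate, map_pow, d.height_even k hk,
        h1, h3, AlgHom.commutes] at this
      simpa [ψ] using this
  obtain ⟨f, hf⟩ := g.exists_algHom χ ψ hcomm hpow
  -- The quotient map by the rules factors through `u(g, χ)`, so the kernel of `freeToRed` is
  -- contained in the ideal of the rules.
  have hfq : f.comp (g.freeToRed χ d) = q := by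
    ext k
    have := hf (d.basis k)
    rw [← g.freeToRed_lin χ d] at this
    simpa [ψ, word_singleton] using this
  have : q z = 0 := by rw [← hfq, AlgHom.comp_apply, hz, map_zero]
  exact Ideal.Quotient.eq_zero_iff_mem.1 this

omit hcube in
theorem exists_functional_red (h2 : (2 : F) ≠ 0) {φ : FreeAlgebra F κ →ₗ[F] F}
    (hφ : d.IsTopFunctional φ) :
    ∃ L : g.ReducedEnveloping χ →ₗ[F] F, ∀ z, L (g.freeToRed χ d z) = φ z := by
  have hker : LinearMap.ker (g.freeToRed χ d).toLinearMap ≤ LinearMap.ker φ := fun z hz =>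
    hφ.map_eq_zero_of_mem (g.mem_relSpan_of_freeToRed_eq_zero χ d hd h2 hz)
  let e := (g.freeToRed χ d).toLinearMap.quotKerEquivOfSurjective (g.freeToRed_surjective χ d)
  refine ⟨(LinearMap.ker (g.freeToRed χ d).toLinearMap).liftQ φ hker ∘ₗ e.symm.toLinearMap,
    fun z => ?_⟩
  have : e.symm (g.freeToRed χ d z) = Submodule.Quotient.mk z := by
    rw [LinearEquiv.symm_apply_eq]
    rfl
  simp [this]

end RestrictedLieSuperalgebra

/-! ### Products under the functional and nondegeneracy of the form -/

namespace LieSuperalgebra.HeightBasis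

open FreeAlgebra LieSuperalgebra

variable {F V : Type*} [Field F] [AddCommGroup V] [Module F V] {g : LieSuperalgebra F V}
  {p : ℕ} {ι : Type*} {d : g.HeightBasis p ι} [Fintype ι] [LinearOrder ι]

namespace IsTopFunctional

variable {φ : FreeAlgebra F ι →ₗ[F] F} (hφ : d.IsTopFunctional φ)

include hφ

/-- Homogeneous elements commute with short words, up to a sign and under the functional. -/
theorem map_supercommutator (h2 : (2 : F) ≠ 0) {i : ZMod 2} {x : V} (hx : x ∈ g.part i)
    (l : List ι) : ∀ A : List ι, A.length + l.length < d.top.length →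
      φ (word F A * (d.lin x * word F l -
        koszulSign F i (d.wordParity l) • (word F l * d.lin x))) = 0 := by
  induction l with
  | nil => intro A _; simp
  | cons k l ih =>
    intro A hA
    simp only [List.length_cons] at hA
    have h1 := hφ.map_context_relLE A l (d.comm_mem h2 hx (d.basis_mem k))
    have h3 := ih (A ++ [k]) (by simp; omega)
    have h4 := hφ.map_lin_eq_zero (A := A) (B := l) (by omega) (g.bracket x (d.basis k))
    have e : word F A * (d.lin x * word F (k :: l) -
          koszulSign F i (d.wordParity (k :: l)) • (word F (k :: l) * d.lin x)) =
        word F A * (d.lin x * d.lin (d.basis k) -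
          koszulSign F i (d.parity k) • (d.lin (d.basis k) * d.lin x) -
          d.lin (g.bracket x (d.basis k))) * word F l +
        word F A * d.lin (g.bracket x (d.basis k)) * word F l +
        koszulSign F i (d.parity k) • (word F (A ++ [k]) * (d.lin x * word F l -
          koszulSign F i (d.wordParity l) • (word F l * d.lin x))) := by
      rw [word_append, word_cons k l, wordParity_cons, koszulSign_add_right, d.lin_basis]
      simp only [mul_sub, sub_mul, smul_sub, mul_smul_comm, smul_mul_assoc, smul_smul, mul_assoc]
      abel
    rw [e, map_add, map_add, map_smul, h1, h3, h4, smul_zero, add_zero, add_zero]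

theorem map_lin_mul_word_of_parity {i : ZMod 2} {x : V} (hx : x ∈ g.part i) {A B : List ι}
    (h : d.wordParity A + i + d.wordParity B ≠ d.wordParity d.top) :
    φ (word F A * d.lin x * word F B) = 0 := by
  refine span_mul_mem (T := LinearMap.ker φ) (fun u hu => ?_) (d.lin_mem_span hx)
  rw [← word_append, ← word_append]
  refine hφ.map_word_of_ne (Or.inr ?_)
  simpa [hu.2, add_assoc] using h

/-- Under the functional, homogeneous elements commute with irreducible words up to a sign,
provided that the supertrace of the adjoint action vanishes. -/
theorem map_supercommutator_irredWord (h2 : (2 : F) ≠ 0) {i : ZMod 2} {x : V}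
    (hx : x ∈ g.part i)
    (htr : x ∈ g.part 0 →
      ∑ k, (d.height k - 1) • d.basis.repr (g.bracket x (d.basis k)) k = 0)
    {u : List ι} (hu : IrredWord d.Rule u) :
    φ (d.lin x * word F u) = koszulSign F i (d.wordParity u) * φ (word F u * d.lin x) := by
  rcases (d.length_le_of_irredWord hu).lt_or_eq with hlt | heq
  · have := hφ.map_supercommutator h2 hx u [] (by simpa using hlt)
    rwa [word_nil, one_mul, map_sub, map_smul, sub_eq_zero, smul_eq_mul] at this
  obtain rfl := d.eq_top_of_length hu heq
  rcases zmod_two_eq_zero_or_one i with rfl | rfl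
  · have := hφ.map_commutator_top h2 hx
    rw [htr hx, map_sub, sub_eq_zero] at this
    rw [this, koszulSign_zero_left, one_mul]
  -- Multiplication by an odd element changes the parity of the highest monomial, so both sides
  -- vanish.
  · have h1 : φ (d.lin x * word F d.top) = 0 := by
      simpa using hφ.map_lin_mul_word_of_parity hx (A := []) (B := d.top) (by simp)
    have h3 : φ (word F d.top * d.lin x) = 0 := by
      simpa using hφ.map_lin_mul_word_of_parity hx (A := d.top) (B := []) (by simp)
    rw [h1, h3, mul_zero]

end IsTopFunctional

omit [LinearOrder ι] in
/-- The trace of the adjoint action on the highest monomial is minus the supertrace. -/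
theorem sum_height_sub_one_smul [CharP F p] (hp : 2 < p) {x : V} (hx : x ∈ g.part 0) :
    ∑ k, (d.height k - 1) • d.basis.repr (g.bracket x (d.basis k)) k =
      -∑ k, koszulSign F (d.parity k) (d.parity k) *
        d.basis.repr (g.bracket x (d.basis k)) k := by
  rw [← Finset.sum_neg_distrib]
  refine Finset.sum_congr rfl fun k _ => ?_
  rcases zmod_two_eq_zero_or_one (d.parity k) with h0 | h0
  -- An even vector has weight `p - 1 = -1` in `F`. An odd one of height two has weight `1`, the
  -- negative of its Koszul sign. One of height one is central, so its diagonal entry is zero.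
  · rw [d.height_even k h0, h0, koszulSign_zero_left, one_mul, nsmul_eq_mul,
      Nat.cast_sub (by omega), CharP.cast_eq_zero]
    simp
  · by_cases h1 : d.height k = 1
    · rw [g.skew hx (d.basis_mem k), d.bracket_of_height_one k h1]
      simp [h1]
    · have hh : d.height k = 2 := by
        have := d.height_pos k
        have := d.height_odd k h0
        omega
      simp [hh, h0]

section Quotient

variable {A : Type*} [Ring A] [Algebra F A] {π : FreeAlgebra F ι →ₐ[F] A}
  (hπ : Function.Surjective π) (hπ0 : ∀ z ∈ relSpan d.Rule Set.univ, π z = 0)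

include hπ0 in
theorem map_word_mem_span (w : List ι) :
    π (word F w) ∈ Submodule.span F ((fun u => π (word F u)) ''
      {u | IrredWord d.Rule u ∧ d.wordParity u = d.wordParity w}) := by
  obtain ⟨y, hy, z, hz, hyz⟩ := Submodule.mem_sup.1 (d.word_mem_sup_irredWord w)
  rw [← hyz, map_add, hπ0 y hy, zero_add]
  have := Submodule.mem_map_of_mem (f := π.toLinearMap) hz
  rw [Submodule.map_span, ← Set.image_comp] at this
  refine Submodule.span_mono ?_ this
  rintro _ ⟨u, hu, rfl⟩
  exact ⟨u, ⟨hu.1, hu.2.2⟩, rfl⟩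

include hπ hπ0

theorem span_irredWord : Submodule.span F ((fun u => π (word F u)) ''
    {u | IrredWord d.Rule u}) = ⊤ := by
  rw [eq_top_iff]
  rintro a -
  obtain ⟨z, rfl⟩ := hπ a
  have hz : z ∈ Submodule.span F (Set.range (word F (ι := ι))) := by
    rw [span_range_word]; trivial
  have := Submodule.mem_map_of_mem (f := π.toLinearMap) hz
  rw [Submodule.map_span] at this
  refine Submodule.span_le.2 ?_ this
  rintro _ ⟨_, ⟨w, rfl⟩, rfl⟩
  exact Submodule.span_mono (Set.image_mono fun u hu => hu.1) (map_word_mem_span hπ0 w)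

theorem finiteDimensional_quotient : FiniteDimensional F A := by
  have hfin : Set.Finite {u | IrredWord d.Rule u} :=
    (List.finite_length_le ι d.top.length).subset fun u hu => d.length_le_of_irredWord hu
  rw [FiniteDimensional, Module.finite_def, ← span_irredWord hπ hπ0]
  exact Submodule.fg_span (hfin.image _)

/-- A nonzero element pairs nontrivially, on either side, with a monomial. -/
theorem exists_pairing_ne_zero (h2 : (2 : F) ≠ 0) {φ : FreeAlgebra F ι →ₗ[F] F}
    (hφ : d.IsTopFunctional φ) {L : A →ₗ[F] F} (hL : ∀ z, L (π z) = φ z) {a : A} (ha : a ≠ 0) :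
    (∃ b, L (a * b) ≠ 0) ∧ ∃ b, L (b * a) ≠ 0 := by
  classical
  have hmem : a ∈ Submodule.span F ((fun u => π (word F u)) '' {u | IrredWord d.Rule u}) := by
    rw [span_irredWord hπ hπ0]; trivial
  rw [Finsupp.mem_span_image_iff_linearCombination] at hmem
  obtain ⟨c, hc, rfl⟩ := hmem
  have hc0 : c ≠ 0 := by
    rintro rfl
    simp at ha
  -- A longest monomial `w` of `a` is completed by `v` to a permutation of the highest monomial.
  -- Every other monomial of `a`, multiplied by `v`, is no longer than that and has the wrong
  -- letters, so only `w` contributes.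
  obtain ⟨w, hw, hmax⟩ := Finset.exists_max_image c.support List.length
    (Finsupp.support_nonempty_iff.2 hc0)
  have hirr : ∀ u ∈ c.support, IrredWord d.Rule u := fun u hu => hc hu
  have hle := d.le_topMultiset_of_irredWord (hirr w hw)
  set v := (d.topMultiset - (w : Multiset ι)).toList with hv
  have hv' : (v : Multiset ι) = d.topMultiset - (w : Multiset ι) := by simp [hv]
  have hvl : v.length + w.length = d.top.length := by
    rw [d.length_top, ← Multiset.coe_card, ← Multiset.coe_card, hv', ← Multiset.card_add,
      tsub_add_cancel_of_le hle]
  have huv : ∀ u ∈ c.support, (u : Multiset ι) + (v : Multiset ι) = d.topMultiset → u = w := by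
    intro u hu h
    refine d.eq_of_irredWord_of_perm (hirr u hu) (hirr w hw) (Multiset.coe_eq_coe.1 ?_)
    exact add_right_cancel (h.trans (by rw [hv', add_tsub_cancel_of_le hle]))
  constructor
  · refine ⟨π (word F v), ?_⟩
    rw [Finsupp.linearCombination_apply, Finsupp.sum, Finset.sum_mul, map_sum,
      Finset.sum_eq_single_of_mem w hw]
    · rw [smul_mul_assoc, map_smul, ← map_mul, hL, ← word_append, smul_eq_mul]
      refine mul_ne_zero (Finsupp.mem_support_iff.1 hw) (hφ.map_ne_zero_of_perm h2 ?_)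
      rw [← Multiset.coe_add, hv', add_tsub_cancel_of_le hle]
    · intro u hu hne
      rw [smul_mul_assoc, map_smul, ← map_mul, hL, ← word_append,
        hφ.map_eq_zero_of_not_perm h2, smul_zero]
      · have := hmax u hu
        simp
        omega
      · rw [← Multiset.coe_add]
        exact fun h => hne (huv u hu h)
  · refine ⟨π (word F v), ?_⟩
    rw [Finsupp.linearCombination_apply, Finsupp.sum, Finset.mul_sum, map_sum,
      Finset.sum_eq_single_of_mem w hw]
    · rw [mul_smul_comm, map_smul, ← map_mul, hL, ← word_append, smul_eq_mul]
      refine mul_ne_zero (Finsupp.mem_support_iff.1 hw) (hφ.map_ne_zero_of_perm h2 ?_)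
      rw [← Multiset.coe_add, hv', tsub_add_cancel_of_le hle]
    · intro u hu hne
      rw [mul_smul_comm, map_smul, ← map_mul, hL, ← word_append,
        hφ.map_eq_zero_of_not_perm h2, smul_zero]
      · have := hmax u hu
        simp
        omega
      · rw [← Multiset.coe_add, add_comm]
        exact fun h => hne (huv u hu h)

/-- The bilinear form `f (a, b) = L (a b)` is nondegenerate. -/
theorem nondegenerate_mul (h2 : (2 : F) ≠ 0) {φ : FreeAlgebra F ι →ₗ[F] F}
    (hφ : d.IsTopFunctional φ) {L : A →ₗ[F] F} (hL : ∀ z, L (π z) = φ z) :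
    LinearMap.BilinForm.Nondegenerate ((LinearMap.mul F A).compr₂ L) := by
  constructor
  · intro a ha
    by_contra hne
    obtain ⟨b, hb⟩ := (exists_pairing_ne_zero hπ hπ0 h2 hφ hL hne).1
    exact hb (ha b)
  · intro a ha
    by_contra hne
    obtain ⟨b, hb⟩ := (exists_pairing_ne_zero hπ hπ0 h2 hφ hL hne).2
    exact hb (ha b)

end Quotient

end LieSuperalgebra.HeightBasis

/-! ### Supersymmetry of the form -/

namespace RestrictedLieSuperalgebra

open LieSuperalgebra FreeAlgebra LieSuperalgebra.HeightBasis

variable {F V : Type*} [Field F] [AddCommGroup V] [Module F V] {p : ℕ}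
  (g : RestrictedLieSuperalgebra F V p) (χ : Module.Dual F (g.part 0))

/-- Reduction preserves parity, so a homogeneous component is spanned by the irreducible words of
its own parity. This allows supersymmetry to be tested on such words. -/
theorem redPart_le_span {κ : Type*} [Fintype κ] [LinearOrder κ] (d : g.HeightBasis p κ)
    (hπ0 : ∀ z ∈ relSpan d.Rule Set.univ, g.freeToRed χ d z = 0) (j : ZMod 2) :
    g.redPart χ j ≤ Submodule.span F ((fun u => g.freeToRed χ d (word F u)) ''
      {u | IrredWord d.Rule u ∧ d.wordParity u = j}) := by
  have h1 : g.redPart χ j ≤ Submodule.span F ((fun u => g.freeToRed χ d (word F u)) ''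
      {u | d.wordParity u = j}) := by
    refine Submodule.span_le.2 ?_
    rintro _ ⟨l, hl, rfl, rfl⟩
    induction l with
    | nil => exact Submodule.subset_span ⟨[], rfl, by simp⟩
    | cons q l ih =>
      have hq := d.lin_mem_span (hl q (by simp))
      have hq' := Submodule.mem_map_of_mem (f := (g.freeToRed χ d).toLinearMap) hq
      rw [Submodule.map_span, ← Set.image_comp] at hq'
      have hmul := Submodule.mul_mem_mul hq' (ih fun r hr => hl r (by simp [hr]))
      rw [Submodule.span_mul_span] at hmul
      simp only [List.map_cons, List.prod_cons, List.sum_cons]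
      have e : (g.freeToRed χ d).toLinearMap (d.lin q.2) = g.redι χ q.2 := g.freeToRed_lin χ d q.2
      rw [e] at hmul
      refine Submodule.span_mono ?_ hmul
      rintro _ ⟨_, ⟨u, hu, rfl⟩, _, ⟨v, hv, rfl⟩, rfl⟩
      refine ⟨u ++ v, ?_, by simp [word_append]⟩
      rw [Set.mem_ofPred_eq, wordParity_append, hu.2]
      congr 1
  refine h1.trans (Submodule.span_le.2 ?_)
  rintro _ ⟨w, rfl, rfl⟩
  exact map_word_mem_span hπ0 w

/-- A functional on a reduced enveloping algebra is supersymmetric as soon as it is so for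
products with elements of the Lie superalgebra. -/
theorem supersymmetric_of_redι {L : g.ReducedEnveloping χ →ₗ[F] F}
    (h : ∀ (i j : ZMod 2) (x : V) (b : g.ReducedEnveloping χ), x ∈ g.part i → b ∈ g.redPart χ j →
      L (g.redι χ x * b) = koszulSign F i j * L (b * g.redι χ x))
    {i j : ZMod 2} {a b : g.ReducedEnveloping χ} (ha : a ∈ g.redPart χ i)
    (hb : b ∈ g.redPart χ j) : L (a * b) = koszulSign F i j * L (b * a) := by
  have key : ∀ (l : List (ZMod 2 × V)), (∀ q ∈ l, q.2 ∈ g.part q.1) → ∀ (j : ZMod 2)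
      (b : g.ReducedEnveloping χ), b ∈ g.redPart χ j →
      L ((l.map fun q => g.redι χ q.2).prod * b) =
        koszulSign F (l.map Prod.fst).sum j * L (b * (l.map fun q => g.redι χ q.2).prod) := by
    intro l
    induction l with
    | nil => intro _ j b _; simp
    | cons q l ih =>
      intro hl j b hb
      have hq := hl q (by simp)
      have hl' : ∀ r ∈ l, r.2 ∈ g.part r.1 := fun r hr => hl r (by simp [hr])
      have hP : (l.map fun q => g.redι χ q.2).prod ∈ g.redPart χ (l.map Prod.fst).sum :=
        Submodule.subset_span ⟨l, hl', rfl, rfl⟩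
      simp only [List.map_cons, List.prod_cons, List.sum_cons]
      -- For a product `x P`, cyclic rotation in two steps: `L (x P b)` becomes `L (P b x)` and then
      -- `L (b x P)`. The sign between `x` and `P` appears twice and cancels.
      rw [mul_assoc, h q.1 _ q.2 _ hq (SetLike.mul_mem_graded hP hb), mul_assoc,
        ih hl' _ _ (SetLike.mul_mem_graded hb (g.redι_mem χ hq)), ← mul_assoc, ← mul_assoc,
        mul_assoc b]
      congr 1
      rw [koszulSign_add_right, koszulSign_add_left, koszulSign_add_right,
        koszulSign_comm F (l.map Prod.fst).sum q.1]
      calc _ = (koszulSign F q.1 (l.map Prod.fst).sum * koszulSign F q.1 (l.map Prod.fst).sum) *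
            (koszulSign F q.1 j * koszulSign F (l.map Prod.fst).sum j) := by ring
        _ = _ := by rw [koszulSign_mul_self, one_mul]
  induction ha using Submodule.span_induction with
  | mem a ha =>
    obtain ⟨l, hl, rfl, rfl⟩ := ha
    exact key l hl j b hb
  | zero => simp
  | add x y _ _ hx hy => rw [add_mul, mul_add, map_add, map_add, hx, hy, mul_add]
  | smul c x _ hx =>
    rw [smul_mul_assoc, mul_smul_comm, map_smul, map_smul, hx, smul_eq_mul, smul_eq_mul]
    ring

end RestrictedLieSuperalgebra

open LieSuperalgebra LieSuperalgebra.HeightBasis in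
theorem proposition5p4 {F V : Type*} [Field F] [IsAlgClosed F] [AddCommGroup V] [Module F V]
    [FiniteDimensional F V] (p : ℕ) [Fact p.Prime] [CharP F p] (hp : 2 < p)
    (g : RestrictedLieSuperalgebra F V p) (χ : Module.Dual F (g.part 0)) :
    IsFrobeniusSuperalgebra (g.redPart χ) ∧
      ((∀ x : V, g.supertrace (g.bracket x) = 0) →
        IsSupersymmetricSuperalgebra (g.redPart χ)) := by
  have h2 : (2 : F) ≠ 0 := by
    have : ((2 : ℕ) : F) ≠ 0 := by
      rw [Ne, CharP.cast_eq_zero_iff F p]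
      exact Nat.not_dvd_of_pos_of_lt two_pos hp
    exact_mod_cast this
  obtain ⟨κ, _, _, d, hd, hcube, htr⟩ := g.exists_heightBasis χ hp h2
  obtain ⟨φ, hφ⟩ := d.exists_isTopFunctional h2
  obtain ⟨L, hL⟩ := g.exists_functional_red χ d hd h2 hφ
  have hπ := g.freeToRed_surjective χ d
  have hπ0 : ∀ z ∈ FreeAlgebra.relSpan d.Rule Set.univ, g.freeToRed χ d z = 0 := fun z hz =>
    g.freeToRed_eq_zero χ d hd hcube h2 hz
  have hfin := finiteDimensional_quotient hπ hπ0
  have hnd := nondegenerate_mul hπ hπ0 h2 hφ hL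
  have hinv : IsInvariantForm ((LinearMap.mul F (g.ReducedEnveloping χ)).compr₂ L) := by
    intro a b c
    simp [mul_assoc]
  refine ⟨⟨hfin, _, hnd, hinv⟩, fun hstr => ⟨hfin, _, hnd, hinv, ?_⟩⟩
  intro i j a b ha hb
  refine g.supersymmetric_of_redι χ (fun i j x b hx hb => ?_) ha hb
  replace hb := g.redPart_le_span χ d hπ0 j hb
  induction hb using Submodule.span_induction with
  | mem b hb =>
    obtain ⟨u, ⟨hu, rfl⟩, rfl⟩ := hb
    simp only [← g.freeToRed_lin χ d, ← map_mul, hL]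
    refine hφ.map_supercommutator_irredWord h2 hx (fun hx => ?_) hu
    -- The obstruction at the highest monomial is `-str (ad x)`, zero by assumption.
    rw [sum_height_sub_one_smul hp hx, ← htr, hstr, neg_zero]
  | zero => simp
  | add x y _ _ hx hy => rw [add_mul, mul_add, map_add, map_add, hx, hy, mul_add]
  | smul c x _ hx =>
    rw [smul_mul_assoc, mul_smul_comm, map_smul, map_smul, hx, smul_eq_mul, smul_eq_mul]
    ring
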